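/- Consider a generalized Pólya urn with $q$ colours: colour $i$ has an activity $a_i\ge 0$ and a random replacement vector $\xi_i=(\xi_{i1},\dots,\xi_{iq})\in\mathbb R^q$, and the initial composition $X_0\in\mathbb R^q$ is nonrandom. Given everything that has happened up to time $n$, a ball of colour $i$ is drawn with probability $a_iX_{ni}/\sum_j a_jX_{nj}$, and if colour $i$ is drawn, then $X_{n+1}=X_n+\Delta X_n$, where $\Delta X_n$ has the distribution of $\xi_i$ and is independent of everything that has happened before. Assume that the urn is tenable, i.e. for every $n\ge0$, a.s. $X_{ni}\ge 0$ for all $i$ and $\sum_i a_iX_{ni}>0$; and that it is balanced, i.e. there is a constant $b>0$ such that $\sum_j a_j\xi_{ij}=b$ a.s. for every $i$. Let $p\ge 2$ be real and assume that $\mathbb E|\xi_{ij}|^p<\infty$ for all $i,j$. Let $A=(a_j\,\mathbb E\xi_{ji})_{i,j=1}^q$ be the intensity matrix. For an eigenvalue $\lambda\in\mathbb C$ of $A$, let $P_\lambda$ be the projection of $\mathbb C^q$ onto the generalized eigenspace of $\lambda$ along the sum of the generalized eigenspaces of the other eigenvalues, let $N_\lambda=AP_\lambda-\lambda P_\lambda$,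 which is nilpotent, and let $\nu_\lambda\ge0$ be the integer with $N_\lambda^{\nu_\lambda}\ne0=N_\lambda^{\nu_\lambda+1}$ (so that $\nu_\lambda+1$ is the size of the largest Jordan block of $A$ with eigenvalue $\lambda$; $N_\lambda^0=I$). For a random vector $Y$ write $\|Y\|_p=(\mathbb E|Y|^p)^{1/p}$, with $|\cdot|$ the Euclidean norm. Then $\|X_n\|_p<\infty$ for every $n\ge0$ (in particular $\mathbb EX_n$ exists), and there is a constant $C_p$, depending only on $p$ and the urn (that is, on $q$, $X_0$, the activities, and the distributions of the $\xi_i$), such that for every eigenvalue $\lambda$ of $A$ and every $n\ge2$, $$\|P_\lambda(X_n-\mathbb EX_n)\|_p\le\begin{cases}C_p\,n^{1/2},&\operatorname{Re}\lambda<b/2,\\ C_p\,n^{1/2}(\log n)^{\nu_\lambda+1/2},&\operatorname{Re}\lambda=b/2,\\ C_p\,n^{\operatorname{Re}\lambda/b}(\log n)^{\nu_\lambda},&\operatorname{Re}\lambda>b/2.\end{cases}$$ -/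

import Mathlib

open MeasureTheory ProbabilityTheory
open scoped ENNReal

noncomputable section

/-! ## Generalized Pólya urns -/

/-- The data of a (generalized) Pólya urn with `q` colours: the activities `a_i ≥ 0`, the
distribution of each random replacement vector `ξ_i` (a probability measure on `ℝ^q`), and the
nonrandom initial composition `X_0`. -/
structure PolyaUrn (q : ℕ) where
  activity : Fin q → ℝ
  activity_nonneg : ∀ i, 0 ≤ activity i
  replacement : Fin q → Measure (EuclideanSpace ℝ (Fin q))
  isProbabilityMeasure_replacement : ∀ i, IsProbabilityMeasure (replacement i)
  init : EuclideanSpace ℝ (Fin q)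

namespace PolyaUrn

variable {q : ℕ}

/-- The total activity `a · x = ∑ j, a_j x_j` of the composition `x`. -/
def totalActivity (U : PolyaUrn q) (x : EuclideanSpace ℝ (Fin q)) : ℝ :=
  ∑ j, U.activity j * x j

/-- The probability `a_i x_i / ∑ j, a_j x_j` that colour `i` is drawn from the composition `x`. -/
def drawProb (U : PolyaUrn q) (i : Fin q) (x : EuclideanSpace ℝ (Fin q)) : ℝ :=
  U.activity i * x i / U.totalActivity x

/-- The urn is balanced with constant `b`: `b > 0` and `a · ξ_i = b` a.s. for every colour `i`. -/
def IsBalanced (U : PolyaUrn q) (b : ℝ) : Prop :=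
  0 < b ∧ ∀ i, ∀ᵐ x ∂U.replacement i, U.totalActivity x = b

/-- All replacements have finite `p`-th absolute moment: `E |ξ_{ij}|^p < ∞` for all `i, j`. -/
def HasFiniteMoments (U : PolyaUrn q) (p : ℝ) : Prop :=
  ∀ i j, Integrable (fun x : EuclideanSpace ℝ (Fin q) => |x j| ^ p) (U.replacement i)

/-- The intensity matrix `A = (a_j E ξ_{ji})_{i,j}`, as a complex matrix. -/
def intensityMatrix (U : PolyaUrn q) : Matrix (Fin q) (Fin q) ℂ :=
  Matrix.of fun i j => ((U.activity j * ∫ x, x i ∂U.replacement j : ℝ) : ℂ)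

/-- The intensity matrix as an operator on `ℂ^q` (with the Euclidean norm). -/
def intensityMap (U : PolyaUrn q) : Module.End ℂ (EuclideanSpace ℂ (Fin q)) :=
  Matrix.toEuclideanLin U.intensityMatrix

/-- `X` is a Pólya urn process with data `U` on the probability space `(Ω, μ)`. Here `X n` is the
composition at time `n`, `draw n` is the colour of the ball drawn at time `n + 1`, and `ℱ n`
contains everything that has happened up to time `n`. The field `step` says that, given `ℱ n`,
colour `i` is drawn with probability `a_i X_{ni} / ∑ j, a_j X_{nj}`, and that if colour `i` is
drawn then `ΔX_n = X_{n+1} - X_n` has the distribution of `ξ_i`, independently of `ℱ n`. -/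
structure IsRealization (U : PolyaUrn q) {Ω : Type*} {m : MeasurableSpace Ω} (μ : Measure Ω)
    (ℱ : Filtration ℕ m) (X : ℕ → Ω → EuclideanSpace ℝ (Fin q)) (draw : ℕ → Ω → Fin q) :
    Prop where
  measurable_X : ∀ n, Measurable[ℱ n] (X n)
  measurable_draw : ∀ n, Measurable[ℱ (n + 1)] (draw n)
  init_eq : ∀ᵐ ω ∂μ, X 0 ω = U.init
  step : ∀ (n : ℕ) (i : Fin q) (F : Set Ω) (B : Set (EuclideanSpace ℝ (Fin q))),
    MeasurableSet[ℱ n] F → MeasurableSet B →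
      μ {ω | ω ∈ F ∧ draw n ω = i ∧ X (n + 1) ω - X n ω ∈ B} =
        (∫⁻ ω in F, ENNReal.ofReal (U.drawProb i (X n ω)) ∂μ) * U.replacement i B

/-- The urn is tenable: for every `n`, almost surely, each `X_{ni} ≥ 0` and the total activity
`∑ i, a_i X_{ni}` is positive. -/
def IsTenable (U : PolyaUrn q) {Ω : Type*} {m : MeasurableSpace Ω} (μ : Measure Ω)
    (X : ℕ → Ω → EuclideanSpace ℝ (Fin q)) : Prop :=
  ∀ n, ∀ᵐ ω ∂μ, (∀ i, 0 ≤ X n ω i) ∧ 0 < U.totalActivity (X n ω)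

end PolyaUrn

/-- A real vector, regarded as a complex vector. -/
def toComplexVec {q : ℕ} (x : EuclideanSpace ℝ (Fin q)) : EuclideanSpace ℂ (Fin q) :=
  WithLp.toLp 2 fun i => (x i : ℂ)

/-! ## Spectral projections -/

section Spectral

variable {V : Type*} [AddCommGroup V] [Module ℂ V] [FiniteDimensional ℂ V]

theorem isCompl_maxGenEigenspace (f : Module.End ℂ V) (lam : ℂ) :
    IsCompl (f.maxGenEigenspace lam) (⨆ (mu : ℂ) (_ : mu ≠ lam), f.maxGenEigenspace mu) := by
  refine ⟨f.independent_maxGenEigenspace lam, codisjoint_iff.mpr ?_⟩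
  rw [← iSup_split_single]
  exact f.iSup_maxGenEigenspace_eq_top

/-- The spectral projection `P_λ` of `f`: the projection onto the generalized eigenspace of `λ`
along the sum of the generalized eigenspaces of all other eigenvalues. -/
def spectralProj (f : Module.End ℂ V) (lam : ℂ) : Module.End ℂ V :=
  Submodule.projection _ _ (isCompl_maxGenEigenspace f lam)

/-- The nilpotent part `N_λ = f P_λ - λ P_λ`. -/
def spectralNilpotent (f : Module.End ℂ V) (lam : ℂ) : Module.End ℂ V :=
  f * spectralProj f lam - lam • spectralProj f lam

/-- `ν_λ`: the least `k` with `N_λ ^ (k + 1) = 0`, i.e. `N_λ ^ ν_λ ≠ 0 = N_λ ^ (ν_λ + 1)`. -/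
def spectralIndex (f : Module.End ℂ V) (lam : ℂ) : ℕ :=
  sInf {k : ℕ | spectralNilpotent f lam ^ (k + 1) = 0}

end Spectral

end

/-! Balance makes the total activity at time `n` the nonrandom number `c n = w + n * b`, where `w`
is its initial value. The conditional mean of the increment is then `(c n)⁻¹ A X_n`, so the urn
follows a linear recursion with deterministic coefficients, perturbed by martingale differences
`Y_n` (`centredIncrement`) whose `L^p` norms are bounded uniformly in `n`. The expectation follows
the same recursion without noise. Variation of constants (`eq_sum_propagator`) therefore writes `X_n
- E X_n` as the sum over `k < n` of `Φ_{k+1,n} Y_k`, where `Φ_{i,n}` is the product of the factors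
`1 + A / c j` for `i ≤ j < n`.

On the range of `P_λ` the matrix acts as `λ + N_λ` with `N_λ` nilpotent. There the product grows at
most like `(c n / c i) ^ ρ`, with `ρ = Re λ / b`, times a polynomial of degree `ν_λ` in `log (c n /
c i)` (`exists_norm_spectralProj_propagator_le`).

For `p ≥ 2` the squared `L^p` norm of a sum of martingale differences is at most a constant times
the sum of their squared `L^p` norms, up to an additive constant
(`eLpNorm_sum_martingaleDifference_le`). Everything thus reduces to summing `(n / k) ^ (2 * ρ)`,
with logarithmic factors, over `k ≤ n`. For `ρ < 1/2` the logarithms are absorbed into a slightly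
larger power and the sum is `O(n)`. For `ρ = 1/2` a harmonic sum contributes one more logarithm. For
`ρ > 1/2` the series over `k` converges. These are the three rates. -/

noncomputable section

/-! ### Moment inequality for sums of martingale differences -/

section MartingaleMoment

/-- The constant in the second order expansion of `|x + d| ^ p`. -/
def expansionConst (p : ℝ) : ℝ := p ^ 2 + (p + 1) ^ p + p ^ p

theorem one_le_expansionConst {p : ℝ} (hp : 2 ≤ p) : 1 ≤ expansionConst p := by
  have h1 : 0 ≤ (p + 1) ^ p := Real.rpow_nonneg (by linarith) _
  have h2 : 0 ≤ p ^ p := Real.rpow_nonneg (by linarith) _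
  unfold expansionConst
  nlinarith

/-- If `p * |d| ≤ |x|`, put `t = d / x`; then `(1 + t) ^ p ≤ exp (p * t) ≤ 1 + p * t + (p * t) ^ 2`
because `|p * t| ≤ 1`, which accounts for the summand `p ^ 2` of the constant. Otherwise `|x| < p *
|d|` and all terms are comparable to `|d| ^ p`: the summand `(p + 1) ^ p` pays for the left side and
`p ^ p` for a negative first-order term. -/
theorem abs_add_rpow_le {p : ℝ} (hp : 2 ≤ p) (x d : ℝ) :
    |x + d| ^ p ≤ |x| ^ p + p * (x * |x| ^ (p - 2)) * d
      + expansionConst p * (|x| ^ (p - 2) * d ^ 2 + |d| ^ p) := by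
  have hp0 : 0 < p := by linarith
  have h1 : 0 ≤ (p + 1) ^ p := Real.rpow_nonneg (by linarith) _
  have h2 : 0 ≤ p ^ p := Real.rpow_nonneg (by linarith) _
  have hA : 0 ≤ |x| ^ (p - 2) * d ^ 2 := by positivity
  have hB : 0 ≤ |d| ^ p := by positivity
  rcases le_or_gt (p * |d|) |x| with h | h
  · rcases eq_or_ne x 0 with rfl | hx
    · have hd : d = 0 := by
        simp only [abs_zero] at h
        have : |d| ≤ 0 := by
          by_contra! hc
          nlinarith
        simpa using this
      subst hd
      simp [Real.zero_rpow hp0.ne']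
    · have hx0 : 0 < |x| := abs_pos.mpr hx
      set t := d / x with ht
      have hd : d = t * x := by rw [ht]; field_simp
      have htp : |p * t| ≤ 1 := by
        rw [abs_mul, abs_of_pos hp0, ht, abs_div, ← mul_div_assoc, div_le_one hx0]
        exact h
      have ht1 : -1 ≤ t := by
        have := (abs_le.mp htp).1
        nlinarith
      have hxp : |x| ^ p = |x| ^ (p - 2) * x ^ 2 := by
        rw [← sq_abs x, ← Real.rpow_natCast, ← Real.rpow_add hx0]
        norm_num
      have hle : (1 + t) ^ p ≤ 1 + p * t + (p * t) ^ 2 := by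
        calc (1 + t) ^ p ≤ (Real.exp t) ^ p :=
              Real.rpow_le_rpow (by linarith) (by linarith [Real.add_one_le_exp t]) hp0.le
          _ = Real.exp (p * t) := by rw [← Real.exp_mul, mul_comm]
          _ ≤ _ := by
            have := (abs_le.mp (Real.abs_exp_sub_one_sub_id_le htp)).2
            linarith
      have hlhs : |x + d| ^ p = |x| ^ p * (1 + t) ^ p := by
        rw [hd, show x + t * x = x * (1 + t) by ring, abs_mul,
          abs_of_nonneg (by linarith : 0 ≤ 1 + t), Real.mul_rpow hx0.le (by linarith)]
      calc |x + d| ^ p ≤ |x| ^ p * (1 + p * t + (p * t) ^ 2) := by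
            rw [hlhs]; gcongr
        _ = |x| ^ p + p * (x * |x| ^ (p - 2)) * d + p ^ 2 * (|x| ^ (p - 2) * d ^ 2) := by
            rw [hxp, hd]; ring
        _ ≤ _ := by
            unfold expansionConst
            nlinarith
  · have hd0 : 0 < |d| := by
      by_contra! hc
      have := abs_nonneg x
      nlinarith
    have e1 : |x + d| ^ p ≤ (p + 1) ^ p * |d| ^ p := by
      rw [← Real.mul_rpow (by linarith) hd0.le]
      exact Real.rpow_le_rpow (abs_nonneg _) ((abs_add_le x d).trans (by linarith)) hp0.le
    have e2 : |x * |x| ^ (p - 2) * d| ≤ p ^ (p - 1) * |d| ^ p := by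
      have : |x| * |x| ^ (p - 2) ≤ (p * |d|) ^ (p - 1) := by
        calc |x| * |x| ^ (p - 2) ≤ (p * |d|) * (p * |d|) ^ (p - 2) := by
              gcongr
          _ = (p * |d|) ^ (p - 1) := by
              rw [← Real.rpow_one_add' (by positivity) (by linarith)]
              ring_nf
      calc |x * |x| ^ (p - 2) * d| = |x| * |x| ^ (p - 2) * |d| := by
            rw [abs_mul, abs_mul, abs_of_nonneg (Real.rpow_nonneg (abs_nonneg x) _)]
        _ ≤ (p * |d|) ^ (p - 1) * |d| := by gcongr
        _ = p ^ (p - 1) * |d| ^ p := by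
            rw [Real.mul_rpow hp0.le hd0.le, mul_assoc, ← Real.rpow_add_one hd0.ne']
            ring_nf
    have e3 : p * p ^ (p - 1) = p ^ p := by
      rw [← Real.rpow_one_add' hp0.le (by linarith)]
      ring_nf
    have e4 : -(p ^ p * |d| ^ p) ≤ p * (x * |x| ^ (p - 2)) * d := by
      have := (abs_le.mp e2).1
      calc -(p ^ p * |d| ^ p) = p * -(p ^ (p - 1) * |d| ^ p) := by rw [← e3]; ring
        _ ≤ p * (x * |x| ^ (p - 2) * d) := by gcongr
        _ = _ := by ring
    have e5 : 0 ≤ |x| ^ p := by positivity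
    unfold expansionConst
    nlinarith [mul_nonneg h1 hA, mul_nonneg h2 hA, mul_nonneg (sq_nonneg p) hA,
      mul_nonneg (sq_nonneg p) hB]

/-- Weighted arithmetic-geometric mean with weights `1 - 2 / p` and `2 / p`. It serves as a
pointwise Hölder inequality: once `m ^ (p / 2)` and `s ^ (p / 2)` bound the `p`-th moments of `x`
and `d`, the bracket integrates to at most `1`. The case `p = 2` needs no separate treatment. -/
theorem young_rpow_sub_two {p : ℝ} (hp : 2 ≤ p) {m s : ℝ} (hm : 0 < m) (hs : 0 < s) (x d : ℝ) :
    |x| ^ (p - 2) * d ^ 2 ≤ m ^ (p / 2 - 1) * s *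
      ((1 - 2 / p) * (|x| ^ p / m ^ (p / 2)) + 2 / p * (|d| ^ p / s ^ (p / 2))) := by
  have hp0 : 0 < p := by linarith
  have h2p : 2 / p ≤ 1 := by rw [div_le_one hp0]; exact hp
  have h := Real.geom_mean_le_arith_mean2_weighted (w₁ := 1 - 2 / p) (w₂ := 2 / p)
    (p₁ := |x| ^ p / m ^ (p / 2)) (p₂ := |d| ^ p / s ^ (p / 2)) (by linarith) (by positivity)
    (by positivity) (by positivity) (by ring)
  have e1 : (|x| ^ p / m ^ (p / 2)) ^ (1 - 2 / p) = |x| ^ (p - 2) / m ^ (p / 2 - 1) := by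
    rw [Real.div_rpow (by positivity) (by positivity), ← Real.rpow_mul (abs_nonneg x),
      ← Real.rpow_mul hm.le]
    congr 2 <;> field_simp
  have e2 : (|d| ^ p / s ^ (p / 2)) ^ (2 / p) = d ^ 2 / s := by
    rw [Real.div_rpow (by positivity) (by positivity), ← Real.rpow_mul (abs_nonneg d),
      ← Real.rpow_mul hs.le]
    rw [show p * (2 / p) = (2 : ℕ) by field_simp; norm_num, Real.rpow_natCast, sq_abs,
      show p / 2 * (2 / p) = 1 by field_simp, Real.rpow_one]
  rw [e1, e2] at h
  calc |x| ^ (p - 2) * d ^ 2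
      = m ^ (p / 2 - 1) * s * (|x| ^ (p - 2) / m ^ (p / 2 - 1) * (d ^ 2 / s)) := by
        field_simp
    _ ≤ _ := by gcongr

/-- The average of two lower bounds for the right side: Bernoulli's inequality yields the term with
`m ^ (r - 1) * s`, superadditivity of `x ^ r` the term with `s ^ r`, each with coefficient `2 * c`.
-/
theorem rpow_add_two_mul_ge {r m s c : ℝ} (hr : 1 ≤ r) (hm : 0 < m) (hs : 0 < s) (hc : 1 ≤ c) :
    m ^ r + c * (m ^ (r - 1) * s + s ^ r) ≤ (m + 2 * c * s) ^ r := by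
  have h1 : m ^ r + 2 * c * (m ^ (r - 1) * s) ≤ (m + 2 * c * s) ^ r := by
    have hu : 0 ≤ 2 * c * s / m := by positivity
    have hb := one_add_mul_self_le_rpow_one_add (by linarith : -1 ≤ 2 * c * s / m) hr
    have hb' : 1 + 2 * c * s / m ≤ (1 + 2 * c * s / m) ^ r := by nlinarith
    calc m ^ r + 2 * c * (m ^ (r - 1) * s) = m ^ r * (1 + 2 * c * s / m) := by
          rw [Real.rpow_sub_one hm.ne']; field_simp
      _ ≤ m ^ r * (1 + 2 * c * s / m) ^ r := by gcongr
      _ = (m + 2 * c * s) ^ r := by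
          rw [← Real.mul_rpow hm.le (by positivity)]; congr 1; field_simp
  have h2 : m ^ r + 2 * c * s ^ r ≤ (m + 2 * c * s) ^ r := by
    have h3 := NNReal.add_rpow_le_rpow_add ⟨m, hm.le⟩ ⟨2 * c * s, by positivity⟩ hr
    have h4 : m ^ r + (2 * c * s) ^ r ≤ (m + 2 * c * s) ^ r := by exact_mod_cast h3
    have h5 : 2 * c * s ^ r ≤ (2 * c * s) ^ r := by
      rw [Real.mul_rpow (by positivity) hs.le]
      gcongr
      exact Real.self_le_rpow_of_one_le (by linarith) hr
    linarith
  linarith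

variable {Ω : Type*} {m0 : MeasurableSpace Ω} {μ : Measure Ω}

theorem MeasureTheory.MemLp.integrable_abs_rpow {p : ℝ} (hp : 0 < p) {f : Ω → ℝ}
    (hf : MemLp f (ENNReal.ofReal p) μ) : Integrable (fun ω => |f ω| ^ p) μ := by
  have := hf.integrable_norm_rpow (by simpa using hp) ENNReal.ofReal_ne_top
  rw [ENNReal.toReal_ofReal hp.le] at this
  simpa using this

variable [IsProbabilityMeasure μ]

/-- One step of the induction, in which bounds on squared `L^p` norms add up to a constant factor.
In the expansion of `|M + d| ^ p` the first-order term integrates to zero, since `M * |M| ^ (p - 2)`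
is `m`-measurable and `d` has conditional mean zero. -/
theorem integral_abs_add_rpow_le {p : ℝ} (hp : 2 ≤ p) {m : MeasurableSpace Ω} (hm : m ≤ m0)
    {M d : Ω → ℝ} (hMm : StronglyMeasurable[m] M) (hM : MemLp M (ENNReal.ofReal p) μ)
    (hd : MemLp d (ENNReal.ofReal p) μ) (hcond : μ[d|m] =ᵐ[μ] 0) {a s : ℝ}
    (ha : 0 < a) (hs : 0 < s) (hMa : ∫ ω, |M ω| ^ p ∂μ ≤ a ^ (p / 2))
    (hds : ∫ ω, |d ω| ^ p ∂μ ≤ s ^ (p / 2)) :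
    ∫ ω, |M ω + d ω| ^ p ∂μ ≤ (a + 2 * expansionConst p * s) ^ (p / 2) := by
  have hp0 : 0 < p := by linarith
  have hc := one_le_expansionConst hp
  have hMi := hM.integrable_abs_rpow hp0
  have hdi := hd.integrable_abs_rpow hp0
  have hsum := (hM.add hd).integrable_abs_rpow hp0
  have hdasm := hd.aestronglyMeasurable
  have hφ : StronglyMeasurable[m] fun ω => M ω * |M ω| ^ (p - 2) := by
    have : Measurable[m] M := hMm.measurable
    exact (this.mul ((measurable_id.abs.pow_const (p - 2)).comp this)).stronglyMeasurable
  have hφd : Integrable (fun ω => M ω * |M ω| ^ (p - 2) * d ω) μ := by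
    refine Integrable.mono' (hMi.add hdi)
      ((hφ.mono hm).aestronglyMeasurable.mul hdasm) (ae_of_all _ fun ω => ?_)
    have h1 : ‖M ω * |M ω| ^ (p - 2) * d ω‖ = |M ω| ^ (p - 1) * |d ω| := by
      rw [Real.norm_eq_abs, abs_mul, abs_mul,
        abs_of_nonneg (Real.rpow_nonneg (abs_nonneg (M ω)) _),
        ← Real.rpow_one_add' (abs_nonneg _) (by linarith)]
      ring_nf
    rw [h1]
    have h2 : |M ω| ^ (p - 1) * |d ω| ≤ max |M ω| |d ω| ^ p := by
      calc |M ω| ^ (p - 1) * |d ω|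
          ≤ max |M ω| |d ω| ^ (p - 1) * max |M ω| |d ω| := by
            gcongr
            · linarith
            · exact le_max_left _ _
            · exact le_max_right _ _
        _ = max |M ω| |d ω| ^ p := by
            rw [← Real.rpow_add_one' (le_max_of_le_left (abs_nonneg _)) (by linarith)]
            ring_nf
    have h3 : max |M ω| |d ω| ^ p ≤ |M ω| ^ p + |d ω| ^ p := by
      rcases max_cases |M ω| |d ω| with h | h <;> rw [h.1] <;>
      linarith [Real.rpow_nonneg (abs_nonneg (M ω)) p, Real.rpow_nonneg (abs_nonneg (d ω)) p]
    exact h2.trans h3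
  have hzero : ∫ ω, M ω * |M ω| ^ (p - 2) * d ω ∂μ = 0 := by
    have hpull := condExp_mul_of_stronglyMeasurable_left (μ := μ) hφ hφd
      (hd.integrable (by rw [← ENNReal.ofReal_one]; exact ENNReal.ofReal_le_ofReal (by linarith)))
    calc ∫ ω, M ω * |M ω| ^ (p - 2) * d ω ∂μ
        = ∫ ω, (μ[(fun ω => M ω * |M ω| ^ (p - 2)) * d|m]) ω ∂μ := (integral_condExp hm).symm
      _ = ∫ ω, 0 ∂μ := by
          refine integral_congr_ae ?_
          filter_upwards [hpull, hcond] with ω h1 h2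
          rw [h1, Pi.mul_apply, h2]
          simp
      _ = 0 := by simp
  set A : ℝ := ∫ ω, |M ω| ^ p ∂μ
  set B : ℝ := ∫ ω, |d ω| ^ p ∂μ
  have hpt : ∀ ω, |M ω + d ω| ^ p ≤ |M ω| ^ p + p * (M ω * |M ω| ^ (p - 2) * d ω)
      + expansionConst p * (a ^ (p / 2 - 1) * s *
        ((1 - 2 / p) * (|M ω| ^ p / a ^ (p / 2)) + 2 / p * (|d ω| ^ p / s ^ (p / 2)))
        + |d ω| ^ p) := fun ω => by
    refine (abs_add_rpow_le hp _ _).trans ?_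
    have := young_rpow_sub_two hp ha hs (M ω) (d ω)
    rw [show p * (M ω * |M ω| ^ (p - 2)) * d ω = p * (M ω * |M ω| ^ (p - 2) * d ω) by ring]
    gcongr
  have hI1 : Integrable (fun ω => (1 - 2 / p) * (|M ω| ^ p / a ^ (p / 2))
      + 2 / p * (|d ω| ^ p / s ^ (p / 2))) μ :=
    ((hMi.div_const (a ^ (p / 2))).const_mul (1 - 2 / p)).add
      ((hdi.div_const (s ^ (p / 2))).const_mul (2 / p))
  have hI2 : Integrable (fun ω => a ^ (p / 2 - 1) * s * ((1 - 2 / p) * (|M ω| ^ p / a ^ (p / 2))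
      + 2 / p * (|d ω| ^ p / s ^ (p / 2))) + |d ω| ^ p) μ :=
    (hI1.const_mul (a ^ (p / 2 - 1) * s)).add hdi
  have hI3 : Integrable (fun ω => |M ω| ^ p + p * (M ω * |M ω| ^ (p - 2) * d ω)) μ :=
    hMi.add (hφd.const_mul p)
  have hint : ∫ ω, |M ω + d ω| ^ p ∂μ ≤ A + p * 0 + expansionConst p *
      (a ^ (p / 2 - 1) * s * ((1 - 2 / p) * (A / a ^ (p / 2)) + 2 / p * (B / s ^ (p / 2)))
        + B) := by
    refine (integral_mono hsum (hI3.add (hI2.const_mul (expansionConst p))) hpt).trans_eq ?_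
    simp only [Pi.add_apply]
    rw [integral_add hI3 (hI2.const_mul _), integral_add hMi (hφd.const_mul p),
      integral_const_mul, integral_const_mul, integral_add (hI1.const_mul _) hdi,
      integral_const_mul, integral_add ((hMi.div_const _).const_mul _)
        ((hdi.div_const _).const_mul _),
      integral_const_mul, integral_const_mul, integral_div, integral_div, hzero]
  have h2p : 2 / p ≤ 1 := by rw [div_le_one hp0]; exact hp
  have hA1 : A / a ^ (p / 2) ≤ 1 := (div_le_one (by positivity)).mpr hMa
  have hB1 : B / s ^ (p / 2) ≤ 1 := (div_le_one (by positivity)).mpr hds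
  have hcomb : (1 - 2 / p) * (A / a ^ (p / 2)) + 2 / p * (B / s ^ (p / 2)) ≤ 1 := by
    have h3 : 0 < 2 / p := by positivity
    nlinarith
  refine hint.trans (le_trans ?_
    (rpow_add_two_mul_ge (r := p / 2) (by linarith) ha hs hc))
  rw [mul_zero, add_zero]
  have hmul := mul_le_of_le_one_right (by positivity : 0 ≤ a ^ (p / 2 - 1) * s) hcomb
  gcongr

/-- The positive starting value `a` is there because each step divides by a power of the current
bound, which would be zero for the empty sum. -/
theorem integral_abs_sum_rpow_le {p : ℝ} (hp : 2 ≤ p) {ℱ : Filtration ℕ m0} {d : ℕ → Ω → ℝ}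
    (hdm : ∀ k, StronglyMeasurable[ℱ (k + 1)] (d k))
    (hd : ∀ k, MemLp (d k) (ENNReal.ofReal p) μ) (hcond : ∀ k, μ[d k|ℱ k] =ᵐ[μ] 0)
    {s : ℕ → ℝ} {n : ℕ} (hs : ∀ k < n, 0 < s k)
    (hds : ∀ k < n, ∫ ω, |d k ω| ^ p ∂μ ≤ s k ^ (p / 2)) {a : ℝ} (ha : 0 < a) :
    ∫ ω, |∑ k ∈ Finset.range n, d k ω| ^ p ∂μ ≤
      (a + 2 * expansionConst p * ∑ k ∈ Finset.range n, s k) ^ (p / 2) := by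
  have hc := one_le_expansionConst hp
  induction n with
  | zero =>
    simp only [Finset.range_zero, Finset.sum_empty, abs_zero, mul_zero, add_zero]
    rw [Real.zero_rpow (by linarith)]
    simp only [integral_zero]
    positivity
  | succ n ih =>
    have ih' := ih (fun k hk => hs k (hk.trans n.lt_succ_self))
      (fun k hk => hds k (hk.trans n.lt_succ_self))
    simp only [Finset.sum_range_succ]
    have hadapt : StronglyMeasurable[ℱ n] fun ω => ∑ k ∈ Finset.range n, d k ω :=
      Finset.stronglyMeasurable_fun_sum _ fun k hk =>
        (hdm k).mono (ℱ.mono (Finset.mem_range.mp hk))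
    have hpos : 0 < a + 2 * expansionConst p * ∑ k ∈ Finset.range n, s k :=
      add_pos_of_pos_of_nonneg ha (mul_nonneg (by linarith) (Finset.sum_nonneg fun k hk =>
        (hs k ((Finset.mem_range.mp hk).trans n.lt_succ_self)).le))
    have := integral_abs_add_rpow_le hp (ℱ.le n) hadapt
      (memLp_finsetSum _ fun k _ => hd k) (hd n) (hcond n) hpos (hs n n.lt_succ_self) ih'
      (hds n n.lt_succ_self)
    rwa [add_assoc, ← mul_add] at this

/-- The `L^p` norm, `p ≥ 2`, of a sum of martingale differences is controlled by the
square root of the sum of the squared `L^p` norms. -/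
theorem eLpNorm_sum_martingaleDifference_le {p : ℝ} (hp : 2 ≤ p) {ℱ : Filtration ℕ m0}
    {d : ℕ → Ω → ℝ} (hdm : ∀ k, StronglyMeasurable[ℱ (k + 1)] (d k))
    (hd : ∀ k, MemLp (d k) (ENNReal.ofReal p) μ) (hcond : ∀ k, μ[d k|ℱ k] =ᵐ[μ] 0)
    {t : ℕ → ℝ} {n : ℕ} (ht : ∀ k < n, 0 < t k)
    (hdt : ∀ k < n, eLpNorm (d k) (ENNReal.ofReal p) μ ≤ ENNReal.ofReal (t k)) {a : ℝ}
    (ha : 0 < a) :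
    eLpNorm (fun ω => ∑ k ∈ Finset.range n, d k ω) (ENNReal.ofReal p) μ ≤
      ENNReal.ofReal √(a + 2 * expansionConst p * ∑ k ∈ Finset.range n, t k ^ 2) := by
  have hp0 : 0 < p := by linarith
  have hpE : ENNReal.ofReal p ≠ 0 := by simpa using hp0
  have hnorm : ∀ f : Ω → ℝ, MemLp f (ENNReal.ofReal p) μ →
      eLpNorm f (ENNReal.ofReal p) μ = ENNReal.ofReal ((∫ ω, |f ω| ^ p ∂μ) ^ p⁻¹) := fun f hf => by
    rw [hf.eLpNorm_eq_integral_rpow_norm hpE ENNReal.ofReal_ne_top, ENNReal.toReal_ofReal hp0.le]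
    rfl
  have hint0 : ∀ f : Ω → ℝ, 0 ≤ ∫ ω, |f ω| ^ p ∂μ := fun f =>
    integral_nonneg fun ω => Real.rpow_nonneg (abs_nonneg _) _
  have hc := one_le_expansionConst hp
  have hsum : 0 ≤ a + 2 * expansionConst p * ∑ k ∈ Finset.range n, t k ^ 2 :=
    add_nonneg ha.le (mul_nonneg (by linarith) (Finset.sum_nonneg fun k _ => sq_nonneg _))
  rw [hnorm _ (memLp_finsetSum _ fun k _ => hd k)]
  refine ENNReal.ofReal_le_ofReal ?_
  have hmain := integral_abs_sum_rpow_le hp hdm hd hcond (s := fun k => t k ^ 2)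
    (fun k hk => pow_pos (ht k hk) 2) (fun k hk => ?_) ha
  · rw [Real.sqrt_eq_rpow]
    calc _ ≤ ((a + 2 * expansionConst p * ∑ k ∈ Finset.range n, t k ^ 2) ^ (p / 2)) ^ p⁻¹ :=
          Real.rpow_le_rpow (hint0 _) hmain (by positivity)
      _ = _ := by
          rw [← Real.rpow_mul hsum]
          congr 1
          field_simp
  · have h1 := hdt k hk
    rw [hnorm _ (hd k), ENNReal.ofReal_le_ofReal_iff (ht k hk).le] at h1
    calc ∫ ω, |d k ω| ^ p ∂μ = ((∫ ω, |d k ω| ^ p ∂μ) ^ p⁻¹) ^ p := by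
          rw [Real.rpow_inv_rpow (hint0 _) hp0.ne']
      _ ≤ t k ^ p := Real.rpow_le_rpow (Real.rpow_nonneg (hint0 _) _) h1 hp0.le
      _ = (t k ^ 2) ^ (p / 2) := by
          rw [← Real.rpow_natCast, ← Real.rpow_mul (ht k hk).le]
          congr 1
          push_cast
          ring

end MartingaleMoment

/-! ### Spectral projections and nilpotent parts -/

section SpectralFacts

variable {V : Type*} [AddCommGroup V] [Module ℂ V] [FiniteDimensional ℂ V]

theorem spectralProj_idem (f : Module.End ℂ V) (lam : ℂ) (x : V) :
    spectralProj f lam (spectralProj f lam x) = spectralProj f lam x :=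
  Submodule.projection_apply_left _ ⟨_, Submodule.projection_apply_mem _ x⟩

/-- An idempotent commutes with `f` exactly when `f` preserves its range and its kernel; here both
are built from generalized eigenspaces. -/
theorem commute_spectralProj (f : Module.End ℂ V) (lam : ℂ) : Commute (spectralProj f lam) f := by
  unfold spectralProj
  rw [LinearMap.IsIdempotentElem.commute_iff (Submodule.isIdempotentElem_projection _)]
  have hmap : ∀ mu : ℂ, f.maxGenEigenspace mu ≤ (f.maxGenEigenspace mu).comap f := fun mu x hx =>
    f.mapsTo_maxGenEigenspace_of_comm (Commute.refl f) mu hx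
  constructor
  · rw [Submodule.range_projection]
    exact hmap lam
  · rw [Submodule.ker_projection, Module.End.mem_invtSubmodule]
    refine iSup₂_le fun mu hmu => (hmap mu).trans (Submodule.comap_mono ?_)
    exact le_iSup₂_of_le mu hmu le_rfl

theorem spectralNilpotent_pow_eq_zero (f : Module.End ℂ V) (lam : ℂ) :
    spectralNilpotent f lam ^ (spectralIndex f lam + 1) = 0 := by
  -- The infimum belongs to its defining set as soon as that set is nonempty. The dimension is a
  -- member, because `N = (f - λ) P` with commuting factors and `(f - λ) ^ finrank` kills the range
  -- of `P`.
  refine Nat.sInf_mem (s := {k : ℕ | spectralNilpotent f lam ^ (k + 1) = 0}) ?_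
  refine ⟨Module.finrank ℂ V, ?_⟩
  have hN : spectralNilpotent f lam = (f - lam • 1) * spectralProj f lam := by
    rw [spectralNilpotent, sub_mul, smul_mul_assoc, one_mul]
  have hcomm : Commute (f - lam • (1 : Module.End ℂ V)) (spectralProj f lam) :=
    ((commute_spectralProj f lam).symm.sub_left ((Commute.one_left _).smul_left lam))
  ext x
  rw [hN, hcomm.mul_pow, Module.End.mul_apply, LinearMap.zero_apply, pow_succ' (spectralProj f lam),
    Module.End.mul_apply]
  have hmem : spectralProj f lam ((spectralProj f lam ^ Module.finrank ℂ V) x) ∈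
      f.maxGenEigenspace lam := Submodule.projection_apply_mem _ _
  rw [Module.End.maxGenEigenspace_eq_genEigenspace_finrank, Module.End.mem_genEigenspace_nat]
    at hmem
  rw [pow_succ', Module.End.mul_apply, LinearMap.mem_ker.mp hmem, map_zero]

theorem apply_eq_of_spectralProj_eq {f : Module.End ℂ V} {lam : ℂ} {y : V}
    (hy : spectralProj f lam y = y) : f y = lam • y + spectralNilpotent f lam y := by
  simp [spectralNilpotent, hy]

end SpectralFacts

/-! ### Growth of the deterministic linear recursion -/

section Growth

theorem norm_one_add_le_exp (z : ℂ) : ‖1 + z‖ ≤ Real.exp (z.re + ‖z‖ ^ 2) := by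
  have h : ‖1 + z‖ ^ 2 ≤ Real.exp (z.re + ‖z‖ ^ 2) ^ 2 := by
    rw [← Real.exp_nat_mul, Complex.sq_norm, Complex.normSq_apply, Complex.sq_norm,
      Complex.normSq_apply]
    simp only [Complex.add_re, Complex.one_re, Complex.add_im, Complex.one_im, zero_add]
    refine le_trans ?_ (Real.add_one_le_exp _)
    push_cast
    nlinarith [sq_nonneg z.re, sq_nonneg z.im]
  exact le_of_sq_le_sq h (Real.exp_pos _).le

variable {V : Type*} [NormedAddCommGroup V] [NormedSpace ℂ V]

/-- Induction on time, simultaneously for all the vectors `N ^ m y`: each is multiplied by `1 + λ /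
c j` and fed by the next one, and the chain stops at `m = nu`. The weight `W` dominates the scalar
products and `L` is a logarithmic clock; each remaining link of the chain costs one factor `1 + (L j
- L i)`, hence the exponent `nu - m`. -/
theorem norm_nilpotent_recursion_le {N : Module.End ℂ V} {nu : ℕ} (hN : N ^ (nu + 1) = 0)
    {lam : ℂ} {c W L : ℕ → ℝ} (hc : ∀ k, 0 < c k) (hWpos : ∀ k, 0 < W k) (hL : Monotone L)
    (hW : ∀ k, ‖1 + lam / c k‖ * W k ≤ W (k + 1))
    (hWL : ∀ k, (c k)⁻¹ * W k ≤ (L (k + 1) - L k) * W (k + 1))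
    {y : ℕ → V} {B : ℝ} {i : ℕ}
    (hy : ∀ j, i ≤ j → y (j + 1) = y j + ((c j : ℂ)⁻¹) • (lam • y j + N (y j)))
    (hB : ∀ m ≤ nu, ‖(N ^ m) (y i)‖ ≤ B) {j : ℕ} (hij : i ≤ j) :
    ∀ m ≤ nu, ‖(N ^ m) (y j)‖ ≤ B * (W j / W i) * (1 + (L j - L i)) ^ (nu - m) := by
  have hB0 : 0 ≤ B := (norm_nonneg _).trans (hB 0 (Nat.zero_le _))
  induction j, hij using Nat.le_induction with
  | base => intro m hm; simpa [(hWpos i).ne'] using hB m hm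
  | succ j hij ih =>
    intro m hm
    have hLj : 0 ≤ L j - L i := sub_nonneg.mpr (hL hij)
    have hstep : 0 ≤ L (j + 1) - L j := sub_nonneg.mpr (hL (Nat.le_succ j))
    have hexp : (N ^ m) (y (j + 1)) =
        (1 + lam / c j) • (N ^ m) (y j) + (c j : ℂ)⁻¹ • (N ^ (m + 1)) (y j) := by
      rw [hy j hij, map_add, map_smul, map_add, map_smul, pow_succ N m, Module.End.mul_apply]
      module
    have hn : ‖(N ^ m) (y (j + 1))‖ ≤
        ‖1 + lam / c j‖ * ‖(N ^ m) (y j)‖ + (c j)⁻¹ * ‖(N ^ (m + 1)) (y j)‖ := by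
      rw [hexp]
      refine (norm_add_le _ _).trans_eq ?_
      rw [norm_smul, norm_smul, norm_inv, Complex.norm_of_nonneg (hc j).le]
    have hcj := inv_pos.mpr (hc j)
    have hWi := hWpos i
    have hWj := hWpos j
    have hWj' := hWpos (j + 1)
    have hfirst : ‖1 + lam / c j‖ * ‖(N ^ m) (y j)‖ ≤
        B * (W (j + 1) / W i) * (1 + (L j - L i)) ^ (nu - m) := by
      calc ‖1 + lam / c j‖ * ‖(N ^ m) (y j)‖
          ≤ ‖1 + lam / c j‖ * (B * (W j / W i) * (1 + (L j - L i)) ^ (nu - m)) := by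
            gcongr
            exact ih m hm
        _ = B * ((‖1 + lam / c j‖ * W j) / W i) * (1 + (L j - L i)) ^ (nu - m) := by ring
        _ ≤ _ := by
            gcongr
            exact hW j
    rcases hm.lt_or_eq with hlt | rfl
    · obtain ⟨k, hk⟩ : ∃ k, nu - m = k + 1 := ⟨nu - m - 1, by omega⟩
      have hk' : nu - (m + 1) = k := by omega
      have hsecond : (c j)⁻¹ * ‖(N ^ (m + 1)) (y j)‖ ≤
          B * (W (j + 1) / W i) * ((L (j + 1) - L j) * (1 + (L j - L i)) ^ k) := by
        calc (c j)⁻¹ * ‖(N ^ (m + 1)) (y j)‖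
            ≤ (c j)⁻¹ * (B * (W j / W i) * (1 + (L j - L i)) ^ k) := by
              gcongr
              rw [← hk']
              exact ih (m + 1) hlt
          _ = B * (((c j)⁻¹ * W j) / W i) * (1 + (L j - L i)) ^ k := by ring
          _ ≤ B * (((L (j + 1) - L j) * W (j + 1)) / W i) * (1 + (L j - L i)) ^ k := by
              exact mul_le_mul_of_nonneg_right (mul_le_mul_of_nonneg_left
                (div_le_div_of_nonneg_right (hWL j) hWi.le) hB0) (by positivity)
          _ = _ := by ring
      have hpow : (1 + (L j - L i)) ^ (k + 1) + (L (j + 1) - L j) * (1 + (L j - L i)) ^ k ≤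
          (1 + (L (j + 1) - L i)) ^ (k + 1) := by
        calc (1 + (L j - L i)) ^ (k + 1) + (L (j + 1) - L j) * (1 + (L j - L i)) ^ k
            = (1 + (L (j + 1) - L i)) * (1 + (L j - L i)) ^ k := by ring
          _ ≤ (1 + (L (j + 1) - L i)) * (1 + (L (j + 1) - L i)) ^ k := by
              have : 0 ≤ 1 + (L (j + 1) - L i) := by linarith
              gcongr
              linarith
          _ = _ := by ring
      rw [hk] at hfirst ⊢
      calc ‖(N ^ m) (y (j + 1))‖ ≤ _ := hn
        _ ≤ _ := add_le_add hfirst hsecond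
        _ = B * (W (j + 1) / W i) * ((1 + (L j - L i)) ^ (k + 1) +
              (L (j + 1) - L j) * (1 + (L j - L i)) ^ k) := by ring
        _ ≤ _ := by gcongr
    · rw [hN, LinearMap.zero_apply, norm_zero, mul_zero, add_zero] at hn
      simp only [Nat.sub_self, pow_zero] at hfirst ⊢
      exact hn.trans hfirst

theorem inv_sub_inv_add {c b : ℝ} (hc : 0 < c) (hb : 0 < b) :
    c⁻¹ - (c + b)⁻¹ = b / (c * (c + b)) := by
  field_simp
  ring

theorem log_add_div_bounds {c b : ℝ} (hc : 0 < c) (hb : 0 < b) :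
    b / (c + b) ≤ Real.log ((c + b) / c) ∧ Real.log ((c + b) / c) ≤ b / c := by
  have hpos : 0 < (c + b) / c := by positivity
  constructor
  · have := Real.one_sub_inv_le_log_of_pos hpos
    calc b / (c + b) = 1 - ((c + b) / c)⁻¹ := by field_simp; ring
      _ ≤ _ := this
  · have := Real.log_le_sub_one_of_pos hpos
    calc _ ≤ (c + b) / c - 1 := this
      _ = b / c := by field_simp; ring

/-- To first order `log |1 + λ / c|` is `(Re λ / b) * log ((c + b) / c)`, with an error of order
`c⁻²`. Bounding that error by a multiple of `c⁻¹ - (c + b)⁻¹` makes it telescope along `c, c + b, c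
+ 2b, ...`. -/
theorem norm_one_add_div_le {w b c : ℝ} (hw : 0 < w) (hb : 0 < b) (hc : w ≤ c) (lam : ℂ) :
    ‖1 + lam / c‖ ≤ ((c + b) / c) ^ (lam.re / b) *
      Real.exp ((‖lam‖ ^ 2 + |lam.re| * b) * (1 + b / w) / b * (c⁻¹ - (c + b)⁻¹)) := by
  have hc0 : 0 < c := hw.trans_le hc
  have hpos : 0 < (c + b) / c := by positivity
  refine (norm_one_add_le_exp _).trans ?_
  rw [Real.rpow_def_of_pos hpos, ← Real.exp_add]
  refine Real.exp_le_exp.mpr ?_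
  obtain ⟨hl, hu⟩ := log_add_div_bounds hc0 hb
  have hre : (lam / c).re = lam.re / c := Complex.div_ofReal_re _ _
  have hnorm : ‖lam / c‖ = ‖lam‖ / c := by
    rw [norm_div, Complex.norm_of_nonneg hc0.le]
  rw [hre, hnorm, inv_sub_inv_add hc0 hb]
  have hdiff : |b / c - Real.log ((c + b) / c)| ≤ b ^ 2 / c ^ 2 := by
    rw [abs_of_nonneg (by linarith)]
    have h1 : b / c - b / (c + b) = b ^ 2 / (c * (c + b)) := by field_simp; ring
    have h2 : b ^ 2 / (c * (c + b)) ≤ b ^ 2 / c ^ 2 := by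
      rw [sq c]
      gcongr
      linarith
    linarith
  have h3 : lam.re / c - Real.log ((c + b) / c) * (lam.re / b) ≤ |lam.re| * b / c ^ 2 := by
    calc lam.re / c - Real.log ((c + b) / c) * (lam.re / b)
        = lam.re / b * (b / c - Real.log ((c + b) / c)) := by field_simp
      _ ≤ |lam.re / b * (b / c - Real.log ((c + b) / c))| := le_abs_self _
      _ = |lam.re| / b * |b / c - Real.log ((c + b) / c)| := by
          rw [abs_mul, abs_div, abs_of_pos hb]
      _ ≤ |lam.re| / b * (b ^ 2 / c ^ 2) := by gcongr
      _ = _ := by field_simp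
  have h4 : 1 / c ^ 2 ≤ (1 + b / w) * (1 / (c * (c + b))) := by
    have h5 : b / c ≤ b / w := by gcongr
    calc 1 / c ^ 2 = (1 + b / c) * (1 / (c * (c + b))) := by field_simp
      _ ≤ _ := by gcongr
  have h6 : (‖lam‖ ^ 2 + |lam.re| * b) * (1 / c ^ 2) ≤
      (‖lam‖ ^ 2 + |lam.re| * b) * ((1 + b / w) * (1 / (c * (c + b)))) := by gcongr
  have h7 : (‖lam‖ ^ 2 + |lam.re| * b) * (1 + b / w) / b * (b / (c * (c + b))) =
      (‖lam‖ ^ 2 + |lam.re| * b) * ((1 + b / w) * (1 / (c * (c + b)))) := by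
    field_simp
  rw [h7]
  have h8 : (‖lam‖ / c) ^ 2 + |lam.re| * b / c ^ 2 =
      (‖lam‖ ^ 2 + |lam.re| * b) * (1 / c ^ 2) := by field_simp
  linarith

theorem inv_le_log_add_div {w b c : ℝ} (hw : 0 < w) (hb : 0 < b) (hc : w ≤ c) :
    c⁻¹ ≤ (1 + b / w) / b * Real.log ((c + b) / c) := by
  have hc0 : 0 < c := hw.trans_le hc
  have h5 : b / c ≤ b / w := by gcongr
  calc c⁻¹ = (1 + b / c) / b * (b / (c + b)) := by field_simp
    _ ≤ (1 + b / w) / b * Real.log ((c + b) / c) := by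
        have := (log_add_div_bounds hc0 hb).1
        gcongr

/-- Solutions of `y_{j+1} = y_j + c_j⁻¹ (λ + N) y_j`, with `N` nilpotent and `c_j = w + j b`,
grow at most like `(c_j / c_i) ^ (Re λ / b)` times a power of the logarithm. -/
theorem exists_norm_recursion_le {N : Module.End ℂ V} {nu : ℕ} (hN : N ^ (nu + 1) = 0)
    (lam : ℂ) {w b : ℝ} (hw : 0 < w) (hb : 0 < b) :
    ∃ C D : ℝ, 0 < C ∧ 0 < D ∧ ∀ (y : ℕ → V) (B : ℝ) (i j : ℕ), i ≤ j →
      (∀ j, i ≤ j → y (j + 1) = y j + (((w + j * b : ℝ) : ℂ)⁻¹) • (lam • y j + N (y j))) →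
      (∀ m ≤ nu, ‖(N ^ m) (y i)‖ ≤ B) →
      ‖y j‖ ≤ C * B * ((w + j * b) / (w + i * b)) ^ (lam.re / b) *
        (1 + D * Real.log ((w + j * b) / (w + i * b))) ^ nu := by
  set rho := lam.re / b with hrho
  set K := (‖lam‖ ^ 2 + |lam.re| * b) * (1 + b / w) / b with hK
  have hK0 : 0 ≤ K := by positivity
  -- The first factor compares `1 / c` with the increment of `log c`. The second compensates for a
  -- possible decrease of the weight `W` over one step when `rho < 0`.
  set D := (1 + b / w) / b * (1 + b / w) ^ |rho| with hD
  set c : ℕ → ℝ := fun k => w + k * b with hcdef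
  have hcw : ∀ k, w ≤ c k := fun k => by
    have : 0 ≤ k * b := by positivity
    simp only [hcdef]; linarith
  have hc : ∀ k, 0 < c k := fun k => hw.trans_le (hcw k)
  have hcs : ∀ k, c (k + 1) = c k + b := fun k => by simp only [hcdef]; push_cast; ring
  -- The exponential absorbs the telescoping errors. It stays between `exp (-(K * w⁻¹))` and `1`, so
  -- it costs only a constant.
  set W : ℕ → ℝ := fun k => c k ^ rho * Real.exp (-(K * (c k)⁻¹)) with hWdef
  have hWpos : ∀ k, 0 < W k := fun k => by
    have := hc k
    simp only [hWdef]; positivity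
  have hWsucc : ∀ k, W (k + 1) = W k * (((c k + b) / c k) ^ rho *
      Real.exp (K * ((c k)⁻¹ - (c k + b)⁻¹))) := fun k => by
    have h1 := hc k
    simp only [hWdef, hcs]
    rw [Real.div_rpow (by linarith) h1.le]
    have : Real.exp (-(K * (c k + b)⁻¹)) =
        Real.exp (-(K * (c k)⁻¹)) * Real.exp (K * ((c k)⁻¹ - (c k + b)⁻¹)) := by
      rw [← Real.exp_add]; ring_nf
    rw [this]
    have := (Real.rpow_pos_of_pos h1 rho).ne'
    field_simp
  have hD0 : 0 < D := by positivity
  refine ⟨Real.exp (K * w⁻¹), D, Real.exp_pos _, hD0, fun y B i j hij hy hB => ?_⟩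
  have hB0 : 0 ≤ B := (norm_nonneg _).trans (hB 0 (Nat.zero_le _))
  have hmono : Monotone fun k => D * Real.log (c k) := by
    refine monotone_nat_of_le_succ fun k => ?_
    have h1 := hc k
    have : Real.log (c k) ≤ Real.log (c (k + 1)) :=
      Real.log_le_log h1 (by rw [hcs]; linarith)
    gcongr
  have key := norm_nilpotent_recursion_le hN (lam := lam) (c := c) (W := W)
    (L := fun k => D * Real.log (c k)) hc hWpos hmono (fun k => ?_) (fun k => ?_)
    hy hB hij 0 (Nat.zero_le _)
  · rw [pow_zero, Module.End.one_apply, Nat.sub_zero, ← mul_sub,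
      ← Real.log_div (hc j).ne' (hc i).ne'] at key
    refine key.trans ?_
    have hlog : 0 ≤ 1 + D * Real.log (c j / c i) := by
      rw [Real.log_div (hc j).ne' (hc i).ne', mul_sub]
      linarith [sub_nonneg.mpr (hmono hij)]
    have hWW : W j / W i ≤ Real.exp (K * w⁻¹) * (c j / c i) ^ rho := by
      have hi := hc i
      have hj := hc j
      have h1 : W j / W i = (c j / c i) ^ rho * Real.exp (K * (c i)⁻¹ - K * (c j)⁻¹) := by
        simp only [hWdef]
        rw [Real.div_rpow hj.le hi.le, sub_eq_add_neg, Real.exp_add, Real.exp_neg (K * (c i)⁻¹)]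
        have := (Real.rpow_pos_of_pos hi rho).ne'
        field_simp
      rw [h1, mul_comm]
      gcongr
      have h2 : 0 ≤ K * (c j)⁻¹ := by positivity
      have h3 : K * (c i)⁻¹ ≤ K * w⁻¹ := by
        have := hcw i
        gcongr
      linarith
    calc B * (W j / W i) * (1 + D * Real.log (c j / c i)) ^ nu
        ≤ B * (Real.exp (K * w⁻¹) * (c j / c i) ^ rho) *
            (1 + D * Real.log (c j / c i)) ^ nu := by gcongr
      _ = _ := by ring
  · rw [hWsucc, mul_comm]
    have := hWpos k
    gcongr
    exact norm_one_add_div_le hw hb (hcw k) lam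
  · have h1 := hc k
    have h2 := hWpos k
    have h3 := inv_le_log_add_div hw hb (hcw k)
    have hlog : 0 ≤ Real.log ((c k + b) / c k) :=
      Real.log_nonneg (by rw [le_div_iff₀ h1]; linarith)
    have hratio : 1 ≤ (1 + b / w) ^ |rho| * (((c k + b) / c k) ^ rho *
        Real.exp (K * ((c k)⁻¹ - (c k + b)⁻¹))) := by
      have h4 : 1 ≤ Real.exp (K * ((c k)⁻¹ - (c k + b)⁻¹)) := by
        rw [inv_sub_inv_add h1 hb]
        exact Real.one_le_exp (by positivity)
      have h5 : (c k + b) / c k ≤ 1 + b / w := by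
        have : b / c k ≤ b / w := by
          have := hcw k
          gcongr
        rw [add_div, div_self h1.ne']
        linarith
      have h6 : 1 ≤ (c k + b) / c k := by rw [le_div_iff₀ h1]; linarith
      have h7 : 1 ≤ (1 + b / w) ^ |rho| * ((c k + b) / c k) ^ rho := by
        calc (1 : ℝ) ≤ ((c k + b) / c k) ^ (|rho| + rho) :=
              Real.one_le_rpow h6 (by linarith [neg_abs_le rho])
          _ = ((c k + b) / c k) ^ |rho| * ((c k + b) / c k) ^ rho :=
              Real.rpow_add (by linarith) _ _
          _ ≤ _ := by gcongr
      rw [← mul_assoc]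
      exact one_le_mul_of_one_le_of_one_le h7 h4
    rw [hWsucc, ← mul_sub, hcs, ← Real.log_div (by linarith) h1.ne', hD]
    calc (c k)⁻¹ * W k ≤ ((1 + b / w) / b * Real.log ((c k + b) / c k)) * W k * 1 := by
          rw [mul_one]; gcongr
      _ ≤ ((1 + b / w) / b * Real.log ((c k + b) / c k)) * W k * ((1 + b / w) ^ |rho| *
          (((c k + b) / c k) ^ rho * Real.exp (K * ((c k)⁻¹ - (c k + b)⁻¹)))) := by
          gcongr
      _ = _ := by ring

end Growth

/-! ### Increments of the urn: law, moments and conditional mean -/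

namespace PolyaUrn

variable {q : ℕ} (U : PolyaUrn q)

/-- The mean `E ξ_i` of the `i`-th replacement vector. -/
def meanReplacement (i : Fin q) : EuclideanSpace ℝ (Fin q) := ∫ x, x ∂U.replacement i

/-- The action `x ↦ ∑ i, a_i x_i E ξ_i` of the intensity matrix on real vectors. -/
def meanDrift (x : EuclideanSpace ℝ (Fin q)) : EuclideanSpace ℝ (Fin q) :=
  ∑ i, (U.activity i * x i) • U.meanReplacement i

/-- The sum over the colours of the `p`-th absolute moments of the replacement vectors. -/
def replacementMoment (p : ℝ) : ℝ≥0∞ := ∑ i, ∫⁻ x, ‖x‖ₑ ^ p ∂U.replacement i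

/-- A bound for the `L^p` norms of the centred increments. -/
def centredIncrementBound (p : ℝ) : ℝ :=
  (U.replacementMoment p ^ (1 / p)).toReal + ∑ i, ‖U.meanReplacement i‖

theorem centredIncrementBound_nonneg (p : ℝ) : 0 ≤ U.centredIncrementBound p :=
  add_nonneg ENNReal.toReal_nonneg (Finset.sum_nonneg fun _ _ => norm_nonneg _)

variable {U}

theorem HasFiniteMoments.memLp {p : ℝ} (hp : 0 < p) (h : U.HasFiniteMoments p) (i : Fin q) :
    MemLp (fun x : EuclideanSpace ℝ (Fin q) => x) (ENNReal.ofReal p) (U.replacement i) := by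
  refine MemLp.of_eval_piLp fun j => ?_
  have hm : AEStronglyMeasurable (fun x : EuclideanSpace ℝ (Fin q) => x j) (U.replacement i) :=
    (EuclideanSpace.proj (𝕜 := ℝ) j).continuous.aestronglyMeasurable
  rw [← integrable_norm_rpow_iff hm (by simpa using hp) ENNReal.ofReal_ne_top,
    ENNReal.toReal_ofReal hp.le]
  exact h i j

theorem HasFiniteMoments.replacementMoment_lt_top {p : ℝ} (hp : 0 < p)
    (h : U.HasFiniteMoments p) : U.replacementMoment p < ∞ := by
  refine ENNReal.sum_lt_top.mpr fun i _ => ?_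
  have := lintegral_rpow_enorm_lt_top_of_eLpNorm_lt_top (by simpa using hp)
    ENNReal.ofReal_ne_top (h.memLp hp i).2
  rwa [ENNReal.toReal_ofReal hp.le] at this

theorem HasFiniteMoments.integrable {p : ℝ} (hp : 1 ≤ p) (h : U.HasFiniteMoments p) (i : Fin q) :
    Integrable (fun x : EuclideanSpace ℝ (Fin q) => x) (U.replacement i) := by
  have := U.isProbabilityMeasure_replacement i
  exact (h.memLp (by linarith) i).integrable (by simpa using hp)

theorem continuous_totalActivity : Continuous U.totalActivity := by
  unfold totalActivity
  fun_prop

theorem totalActivity_sub (x y : EuclideanSpace ℝ (Fin q)) :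
    U.totalActivity (x - y) = U.totalActivity x - U.totalActivity y := by
  simp [totalActivity, mul_sub, Finset.sum_sub_distrib]

theorem continuous_meanDrift : Continuous U.meanDrift := by
  unfold meanDrift
  fun_prop

theorem measurable_const_smul_meanDrift (c : ℝ) : Measurable fun x => c • U.meanDrift x :=
  (continuous_meanDrift.const_smul c).measurable

theorem measurable_drawProb (i : Fin q) : Measurable (U.drawProb i) := by
  unfold drawProb
  exact ((EuclideanSpace.proj (𝕜 := ℝ) i).continuous.measurable.const_mul _).div
    continuous_totalActivity.measurable

theorem drawProb_nonneg {x : EuclideanSpace ℝ (Fin q)} (hx : ∀ i, 0 ≤ x i)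
    (i : Fin q) : 0 ≤ U.drawProb i x :=
  div_nonneg (mul_nonneg (U.activity_nonneg i) (hx i))
    (Finset.sum_nonneg fun j _ => mul_nonneg (U.activity_nonneg j) (hx j))

theorem drawProb_le_one {x : EuclideanSpace ℝ (Fin q)} (hx : ∀ i, 0 ≤ x i) (i : Fin q) :
    U.drawProb i x ≤ 1 :=
  div_le_one_of_le₀ (Finset.single_le_sum (f := fun j => U.activity j * x j)
    (fun j _ => mul_nonneg (U.activity_nonneg j) (hx j)) (Finset.mem_univ i))
    (Finset.sum_nonneg fun j _ => mul_nonneg (U.activity_nonneg j) (hx j))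

theorem inv_smul_meanDrift (x : EuclideanSpace ℝ (Fin q)) :
    (U.totalActivity x)⁻¹ • U.meanDrift x = ∑ i, U.drawProb i x • U.meanReplacement i := by
  rw [meanDrift, Finset.smul_sum]
  refine Finset.sum_congr rfl fun i _ => ?_
  rw [smul_smul, drawProb, div_eq_inv_mul]

/-- The normalized drift combines the mean replacements with drawing probabilities in `[0, 1]`, so
it is bounded however large the composition is. -/
theorem norm_inv_smul_meanDrift_le {x : EuclideanSpace ℝ (Fin q)} (hx : ∀ i, 0 ≤ x i) :
    ‖(U.totalActivity x)⁻¹ • U.meanDrift x‖ ≤ ∑ i, ‖U.meanReplacement i‖ := by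
  rw [inv_smul_meanDrift]
  refine (norm_sum_le _ _).trans (Finset.sum_le_sum fun i _ => ?_)
  rw [norm_smul, Real.norm_of_nonneg (drawProb_nonneg hx i)]
  exact mul_le_of_le_one_left (norm_nonneg _) (drawProb_le_one hx i)

variable {Ω : Type*} {m : MeasurableSpace Ω} {μ : Measure Ω} {ℱ : Filtration ℕ m}
  {X : ℕ → Ω → EuclideanSpace ℝ (Fin q)} {draw : ℕ → Ω → Fin q}

namespace IsRealization

variable (hR : U.IsRealization μ ℱ X draw)
include hR

theorem measurable (n : ℕ) : Measurable (X n) := (hR.measurable_X n).mono (ℱ.le n) le_rfl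

theorem measurable_increment (n : ℕ) : Measurable fun ω => X (n + 1) ω - X n ω :=
  (hR.measurable (n + 1)).sub (hR.measurable n)

/-- The law of the increment on an event of the past is a mixture of the replacement laws. -/
theorem map_increment (n : ℕ) {F : Set Ω} (hF : MeasurableSet[ℱ n] F) :
    (μ.restrict F).map (fun ω => X (n + 1) ω - X n ω) =
      ∑ i, (∫⁻ ω in F, ENNReal.ofReal (U.drawProb i (X n ω)) ∂μ) • U.replacement i := by
  ext B hB
  have hFm := ℱ.le n F hF
  have hpre := hR.measurable_increment n hB
  rw [Measure.map_apply (hR.measurable_increment n) hB, Measure.restrict_apply hpre,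
    Measure.finsetSum_apply]
  simp only [Measure.smul_apply, smul_eq_mul]
  simp_rw [← hR.step n _ F B hF hB]
  -- The event is split according to the colour drawn; the pieces are disjoint.
  rw [← tsum_fintype (L := .unconditional _), ← measure_iUnion]
  · congr 1
    ext ω
    simp only [Set.mem_inter_iff, Set.mem_preimage, Set.mem_iUnion, Set.mem_ofPred_eq]
    constructor
    · rintro ⟨h1, h2⟩
      exact ⟨draw n ω, h2, rfl, h1⟩
    · rintro ⟨i, h1, -, h2⟩
      exact ⟨h2, h1⟩
  · intro i j hij
    refine Set.disjoint_left.mpr fun ω h1 h2 => hij ?_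
    exact h1.2.1.symm.trans h2.2.1
  · intro i
    have hd : Measurable (draw n) := (hR.measurable_draw n).mono (ℱ.le (n + 1)) le_rfl
    exact hFm.inter ((hd (measurableSet_singleton i)).inter hpre)

theorem ae_increment {S : Set (EuclideanSpace ℝ (Fin q))}
    (h : ∀ i, ∀ᵐ x ∂U.replacement i, x ∈ S) (n : ℕ) : ∀ᵐ ω ∂μ, X (n + 1) ω - X n ω ∈ S := by
  have h1 := hR.map_increment n (F := Set.univ) MeasurableSet.univ
  rw [Measure.restrict_univ] at h1
  refine ae_of_ae_map (hR.measurable_increment n).aemeasurable ?_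
  rw [h1, ae_iff]
  change (∑ i, (∫⁻ ω, ENNReal.ofReal (U.drawProb i (X n ω)) ∂μ) •
    U.replacement i) Sᶜ = 0
  rw [Measure.finsetSum_apply]
  refine Finset.sum_eq_zero fun i _ => ?_
  rw [Measure.smul_apply, show U.replacement i Sᶜ = 0 from h i, smul_zero]

/-- This is the whole use of balance: the denominator of the drawing probabilities becomes
deterministic, and with it the coefficients of the recursion. -/
theorem ae_totalActivity_eq {b : ℝ} (hb : U.IsBalanced b) (n : ℕ) :
    ∀ᵐ ω ∂μ, U.totalActivity (X n ω) = U.totalActivity U.init + n * b := by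
  induction n with
  | zero =>
    filter_upwards [hR.init_eq] with ω hω
    simp [hω]
  | succ n ih =>
    filter_upwards [ih, hR.ae_increment (S := {x | U.totalActivity x = b}) hb.2 n] with ω h1 h2
    have h2 : U.totalActivity (X (n + 1) ω - X n ω) = b := h2
    rw [totalActivity_sub] at h2
    push_cast
    linarith

variable [IsProbabilityMeasure μ]

theorem lintegral_drawProb_le_one (n : ℕ) (i : Fin q) :
    ∫⁻ ω, ENNReal.ofReal (U.drawProb i (X n ω)) ∂μ ≤ 1 := by
  have h := hR.step n i Set.univ Set.univ MeasurableSet.univ MeasurableSet.univ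
  have := U.isProbabilityMeasure_replacement i
  rw [Measure.restrict_univ, measure_univ, mul_one] at h
  rw [← h]
  exact prob_le_one

/-- The law of the increment is a mixture of replacement laws with weights at most `1`. Dropping the
weights gives a bound that does not depend on `n`. -/
theorem lintegral_increment_le (n : ℕ) {g : EuclideanSpace ℝ (Fin q) → ℝ≥0∞}
    (hg : Measurable g) :
    ∫⁻ ω, g (X (n + 1) ω - X n ω) ∂μ ≤ ∑ i, ∫⁻ x, g x ∂U.replacement i := by
  have h := hR.map_increment n (F := Set.univ) MeasurableSet.univ
  rw [Measure.restrict_univ] at h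
  rw [← lintegral_map hg (hR.measurable_increment n), h, lintegral_finsetSum_measure]
  simp only [lintegral_smul_measure, smul_eq_mul]
  exact Finset.sum_le_sum fun i _ =>
    mul_le_of_le_one_left zero_le (hR.lintegral_drawProb_le_one n i)

theorem eLpNorm_increment_le {p : ℝ} (hp : 0 < p) (n : ℕ) :
    eLpNorm (fun ω => X (n + 1) ω - X n ω) (ENNReal.ofReal p) μ ≤
      U.replacementMoment p ^ (1 / p) := by
  rw [eLpNorm_eq_lintegral_rpow_enorm_toReal (by simpa using hp) ENNReal.ofReal_ne_top,
    ENNReal.toReal_ofReal hp.le]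
  gcongr
  exact hR.lintegral_increment_le n (g := fun x => ‖x‖ₑ ^ p) (by fun_prop)

theorem memLp_increment {p : ℝ} (hp : 0 < p) (hmom : U.HasFiniteMoments p) (n : ℕ) :
    MemLp (fun ω => X (n + 1) ω - X n ω) (ENNReal.ofReal p) μ :=
  ⟨(hR.measurable_increment n).aestronglyMeasurable, (hR.eLpNorm_increment_le hp n).trans_lt
    (ENNReal.rpow_lt_top_of_nonneg (by positivity) (hmom.replacementMoment_lt_top hp).ne)⟩

theorem memLp {p : ℝ} (hp : 0 < p) (hmom : U.HasFiniteMoments p) (n : ℕ) :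
    MemLp (X n) (ENNReal.ofReal p) μ := by
  induction n with
  | zero =>
    refine (memLp_congr_ae ?_).mpr (memLp_const U.init)
    exact hR.init_eq
  | succ n ih =>
    have := ih.add (hR.memLp_increment hp hmom n)
    convert this using 1
    ext1 ω
    simp

/-- Conditional expectations are determined by integrals over events `F` of the past, and
`map_increment` gives the law of the increment on each such `F`. -/
theorem condExp_increment {p : ℝ} (hp : 1 ≤ p) (hmom : U.HasFiniteMoments p)
    (hT : U.IsTenable μ X) (n : ℕ) :
    μ[fun ω => X (n + 1) ω - X n ω|ℱ n] =ᵐ[μ]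
      fun ω => ∑ i, U.drawProb i (X n ω) • U.meanReplacement i := by
  have hp0 : 0 < p := by linarith
  have hint : Integrable (fun ω => X (n + 1) ω - X n ω) μ :=
    (hR.memLp_increment hp0 hmom n).integrable (by simpa using hp)
  have hpi : ∀ i, Integrable (fun ω => U.drawProb i (X n ω)) μ := fun i => by
    refine Integrable.of_bound
      ((measurable_drawProb i).comp (hR.measurable n)).aestronglyMeasurable 1 ?_
    filter_upwards [hT n] with ω hω
    rw [Real.norm_of_nonneg (drawProb_nonneg hω.1 i)]
    exact drawProb_le_one hω.1 i
  symm
  refine ae_eq_condExp_of_forall_setIntegral_eq (ℱ.le n) hint (fun F _ _ => ?_)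
    (fun F hF _ => ?_) ?_
  · exact (integrable_finsetSum _ fun i _ => (hpi i).smul_const _).integrableOn
  · have hlhs : ∫ ω in F, X (n + 1) ω - X n ω ∂μ = ∫ x, x ∂(μ.restrict F).map
        (fun ω => X (n + 1) ω - X n ω) :=
      (integral_map (hR.measurable_increment n).aemeasurable
        aestronglyMeasurable_id).symm
    have hfin : ∀ i, ∫⁻ ω in F, ENNReal.ofReal (U.drawProb i (X n ω)) ∂μ ≠ ∞ := fun i =>
      ((setLIntegral_le_lintegral F _).trans_lt
        ((hR.lintegral_drawProb_le_one n i).trans_lt ENNReal.one_lt_top)).ne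
    rw [hlhs, hR.map_increment n hF, integral_finsetSum_measure
      (fun i _ => (hmom.integrable hp i).smul_measure (hfin i)),
      integral_finsetSum _ fun i _ => ((hpi i).smul_const _).integrableOn]
    refine Finset.sum_congr rfl fun i _ => ?_
    rw [integral_smul_const, integral_smul_measure, integral_eq_lintegral_of_nonneg_ae]
    · rfl
    · refine ae_restrict_of_ae ?_
      filter_upwards [hT n] with ω hω
      exact drawProb_nonneg hω.1 i
    · exact (hpi i).aestronglyMeasurable.restrict
  · refine (Finset.stronglyMeasurable_fun_sum _ fun i _ => ?_).aestronglyMeasurable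
    exact (((measurable_drawProb i).comp (hR.measurable_X n)).stronglyMeasurable).smul_const _

end IsRealization

/-- The increment at time `n`, centred at its conditional mean given the past. -/
def centredIncrement (U : PolyaUrn q) (b : ℝ) (X : ℕ → Ω → EuclideanSpace ℝ (Fin q)) (n : ℕ)
    (ω : Ω) : EuclideanSpace ℝ (Fin q) :=
  X (n + 1) ω - X n ω - (U.totalActivity U.init + n * b)⁻¹ • U.meanDrift (X n ω)

namespace IsRealization

variable (hR : U.IsRealization μ ℱ X draw)
include hR

theorem stronglyMeasurable_centredIncrement (b : ℝ) (n : ℕ) :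
    StronglyMeasurable[ℱ (n + 1)] (U.centredIncrement b X n) := by
  have h1 := hR.measurable_X (n + 1)
  have h2 : Measurable[ℱ (n + 1)] (X n) :=
    (hR.measurable_X n).mono (ℱ.mono (Nat.le_succ n)) le_rfl
  exact ((h1.sub h2).sub
    ((measurable_const_smul_meanDrift _).comp h2)).stronglyMeasurable

theorem ae_scaled_meanDrift_eq {b : ℝ} (hb : U.IsBalanced b) (n : ℕ) :
    ∀ᵐ ω ∂μ, (U.totalActivity U.init + n * b)⁻¹ • U.meanDrift (X n ω) =
      (U.totalActivity (X n ω))⁻¹ • U.meanDrift (X n ω) := by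
  filter_upwards [hR.ae_totalActivity_eq hb n] with ω hω
  rw [hω]

variable [IsProbabilityMeasure μ]

theorem memLp_scaled_meanDrift {b : ℝ} (hb : U.IsBalanced b) (hT : U.IsTenable μ X) (n : ℕ)
    (r : ℝ≥0∞) :
    MemLp (fun ω => (U.totalActivity U.init + n * b)⁻¹ • U.meanDrift (X n ω)) r μ := by
  refine MemLp.of_bound ((measurable_const_smul_meanDrift _).comp
    (hR.measurable n)).aestronglyMeasurable (∑ i, ‖U.meanReplacement i‖) ?_
  filter_upwards [hR.ae_scaled_meanDrift_eq hb n, hT n] with ω h1 h2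
  rw [h1]
  exact norm_inv_smul_meanDrift_le h2.1

theorem memLp_centredIncrement {b p : ℝ} (hb : U.IsBalanced b) (hp : 0 < p)
    (hmom : U.HasFiniteMoments p) (hT : U.IsTenable μ X) (n : ℕ) :
    MemLp (U.centredIncrement b X n) (ENNReal.ofReal p) μ :=
  (hR.memLp_increment hp hmom n).sub (hR.memLp_scaled_meanDrift hb hT n _)

theorem condExp_centredIncrement {b p : ℝ} (hb : U.IsBalanced b) (hp : 1 ≤ p)
    (hmom : U.HasFiniteMoments p) (hT : U.IsTenable μ X) (n : ℕ) :
    μ[U.centredIncrement b X n|ℱ n] =ᵐ[μ] 0 := by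
  have hint : Integrable (fun ω => X (n + 1) ω - X n ω) μ :=
    (hR.memLp_increment (by linarith) hmom n).integrable (by simpa using hp)
  have hdrift := (hR.memLp_scaled_meanDrift hb hT n 1).integrable le_rfl
  have hmeas : StronglyMeasurable[ℱ n]
      fun ω => (U.totalActivity U.init + n * b)⁻¹ • U.meanDrift (X n ω) :=
    ((measurable_const_smul_meanDrift _).comp (hR.measurable_X n)).stronglyMeasurable
  have h1 := condExp_sub hint hdrift (ℱ n)
  rw [condExp_of_stronglyMeasurable (ℱ.le n) hmeas hdrift] at h1
  filter_upwards [h1, hR.condExp_increment hp hmom hT n, hR.ae_scaled_meanDrift_eq hb n]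
    with ω h2 h3 h4
  refine h2.trans ?_
  rw [Pi.sub_apply, h3, h4, inv_smul_meanDrift, sub_self]
  rfl

theorem eLpNorm_centredIncrement_le {b p : ℝ} (hb : U.IsBalanced b) (hp : 1 ≤ p)
    (hmom : U.HasFiniteMoments p) (hT : U.IsTenable μ X) (n : ℕ) :
    eLpNorm (U.centredIncrement b X n) (ENNReal.ofReal p) μ ≤
      ENNReal.ofReal (U.centredIncrementBound p) := by
  have hp0 : 0 < p := by linarith
  have hdrift := hR.memLp_scaled_meanDrift hb hT n (ENNReal.ofReal p)
  refine (eLpNorm_sub_le (hR.memLp_increment hp0 hmom n).1 hdrift.1 (by simpa using hp)).trans ?_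
  rw [centredIncrementBound, ENNReal.ofReal_add ENNReal.toReal_nonneg
    (Finset.sum_nonneg fun _ _ => norm_nonneg _), ENNReal.ofReal_toReal
    (ENNReal.rpow_lt_top_of_nonneg (by positivity) (hmom.replacementMoment_lt_top hp0).ne).ne]
  refine add_le_add (hR.eLpNorm_increment_le hp0 n) ?_
  refine (eLpNorm_le_of_ae_bound (C := ∑ i, ‖U.meanReplacement i‖) ?_).trans ?_
  · filter_upwards [hR.ae_scaled_meanDrift_eq hb n, hT n] with ω h1 h2
    rw [h1]
    exact norm_inv_smul_meanDrift_le h2.1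
  · simp

end IsRealization

end PolyaUrn

/-! ### Sums of squared growth factors -/

section Sums

/-- A discrete comparison with an integral: Bernoulli's inequality for the exponent `1 - s ≤ 1`
bounds each summand by an increment of `n ^ (1 - s) / (1 - s)`. -/
theorem sum_inv_rpow_le {s : ℝ} (hs0 : 0 ≤ s) (hs1 : s < 1) (n : ℕ) :
    ∑ k ∈ Finset.range n, (((k : ℝ) + 1) ^ s)⁻¹ ≤ (n : ℝ) ^ (1 - s) / (1 - s) := by
  have h1s : 0 < 1 - s := by linarith
  induction n with
  | zero => simp [Real.zero_rpow h1s.ne']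
  | succ n ih =>
    rw [Finset.sum_range_succ]
    have hn : (0 : ℝ) < n + 1 := by positivity
    have hber := rpow_one_add_le_one_add_mul_self (s := -(1 / ((n : ℝ) + 1)))
      (by rw [neg_le_neg_iff, div_le_one hn]; linarith [Nat.cast_nonneg (α := ℝ) n])
      h1s.le (by linarith)
    have hstep : (n : ℝ) ^ (1 - s) ≤ ((n : ℝ) + 1) ^ (1 - s) - (1 - s) * (((n : ℝ) + 1) ^ s)⁻¹ := by
      calc (n : ℝ) ^ (1 - s) = ((n : ℝ) + 1) ^ (1 - s) * (1 + -(1 / ((n : ℝ) + 1))) ^ (1 - s) := by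
            have h : 1 + -(1 / ((n : ℝ) + 1)) = n / (n + 1) := by field_simp; ring
            rw [h, Real.div_rpow (Nat.cast_nonneg n) hn.le]
            field_simp
        _ ≤ ((n : ℝ) + 1) ^ (1 - s) * (1 + (1 - s) * -(1 / ((n : ℝ) + 1))) := by gcongr
        _ = _ := by
            rw [Real.rpow_sub hn, Real.rpow_one]
            field_simp
            ring
    have : (n : ℝ) ^ (1 - s) / (1 - s) + (((n : ℝ) + 1) ^ s)⁻¹ ≤
        ((n : ℝ) + 1) ^ (1 - s) / (1 - s) := by
      rw [div_add' _ _ _ h1s.ne']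
      gcongr
      linarith
    push_cast
    linarith

theorem sum_inv_le_one_add_log (n : ℕ) :
    ∑ k ∈ Finset.range n, ((k : ℝ) + 1)⁻¹ ≤ 1 + Real.log n := by
  have h := harmonic_le_one_add_log n
  simpa [harmonic] using h

theorem exists_sum_inv_rpow_le {s : ℝ} (hs : 1 < s) :
    ∃ K : ℝ, 0 < K ∧ ∀ n : ℕ, ∑ k ∈ Finset.range n, (((k : ℝ) + 1) ^ s)⁻¹ ≤ K := by
  have hsum : Summable fun k : ℕ => (((k : ℝ) + 1) ^ s)⁻¹ := by
    have := (summable_nat_add_iff 1).mpr (Real.summable_nat_rpow_inv.mpr hs)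
    simpa using this
  have hnn : ∀ k : ℕ, 0 ≤ (((k : ℝ) + 1) ^ s)⁻¹ := fun k => by positivity
  refine ⟨∑' k : ℕ, (((k : ℝ) + 1) ^ s)⁻¹ + 1,
    add_pos_of_nonneg_of_pos (tsum_nonneg hnn) one_pos, fun n => ?_⟩
  have := hsum.sum_le_tsum (Finset.range n) fun k _ => hnn k
  linarith

theorem exists_rpow_mul_log_pow_le {rho sigma : ℝ} (h : rho < sigma) {D : ℝ} (hD : 0 < D)
    (nu : ℕ) : ∃ K : ℝ, 0 < K ∧ ∀ x : ℝ, 1 ≤ x →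
      x ^ rho * (1 + D * Real.log x) ^ nu ≤ K * x ^ sigma := by
  -- Each of the `nu` logarithmic factors is traded for `x ^ e`, and `rho + e * nu ≤ sigma`;
  -- dividing by `nu + 1` also covers `nu = 0`.
  set e := (sigma - rho) / (nu + 1) with he
  have he0 : 0 < e := div_pos (by linarith) (by positivity)
  refine ⟨(1 + D / e) ^ nu, by positivity, fun x hx => ?_⟩
  have hx0 : 0 < x := by linarith
  have hlog := Real.log_nonneg hx
  have h1 : 1 + D * Real.log x ≤ (1 + D / e) * x ^ e := by
    have h2 := Real.log_le_rpow_div hx0.le he0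
    have h3 := Real.one_le_rpow hx he0.le
    calc 1 + D * Real.log x ≤ x ^ e + D * (x ^ e / e) := by gcongr
      _ = _ := by ring
  calc x ^ rho * (1 + D * Real.log x) ^ nu ≤ x ^ rho * ((1 + D / e) * x ^ e) ^ nu := by gcongr
    _ = (1 + D / e) ^ nu * (x ^ (rho + e * nu)) := by
        rw [mul_pow, Real.rpow_add hx0, Real.rpow_mul_natCast hx0.le]; ring
    _ ≤ (1 + D / e) ^ nu * x ^ sigma := by
        gcongr
        have : e * (nu + 1) = sigma - rho := by rw [he]; field_simp
        linarith

/-- The growth factor of the recursion with `c_j = w + j b` between the times `i` and `n`. -/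
def growthFactor (w b rho D : ℝ) (nu n i : ℕ) : ℝ :=
  ((w + n * b) / (w + i * b)) ^ rho * (1 + D * Real.log ((w + n * b) / (w + i * b))) ^ nu

variable {w b : ℝ}

theorem one_le_ratio (hw : 0 < w) (hb : 0 < b) {n i : ℕ} (hin : i ≤ n) :
    1 ≤ (w + n * b) / (w + i * b) := by
  rw [le_div_iff₀ (by positivity)]
  have : (i : ℝ) ≤ n := by exact_mod_cast hin
  nlinarith

theorem ratio_le (hw : 0 < w) (hb : 0 < b) {n k : ℕ} (hn : 1 ≤ n) :
    (w + n * b) / (w + (k + 1 : ℕ) * b) ≤ (w + b) / b * n / (k + 1) := by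
  have hn' : (1 : ℝ) ≤ n := by exact_mod_cast hn
  calc (w + n * b) / (w + (k + 1 : ℕ) * b) ≤ ((w + b) * n) / ((k + 1) * b) := by
        gcongr
        · nlinarith
        · push_cast; linarith
    _ = _ := by field_simp

theorem growthFactor_pos (hw : 0 < w) (hb : 0 < b) {rho D : ℝ} (hD : 0 < D) {nu n i : ℕ}
    (hin : i ≤ n) : 0 < growthFactor w b rho D nu n i := by
  have h := one_le_ratio hw hb hin
  have := Real.log_nonneg h
  unfold growthFactor
  positivity

theorem exists_one_add_log_ratio_le (hw : 0 < w) (hb : 0 < b) {D : ℝ} (hD : 0 < D) :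
    ∃ K : ℝ, 0 < K ∧ ∀ n k : ℕ, 2 ≤ n →
      1 + D * Real.log ((w + n * b) / (w + (k + 1 : ℕ) * b)) ≤ K * Real.log n := by
  have hl2 : 0 < Real.log 2 := Real.log_pos one_lt_two
  have ha : 1 ≤ (w + b) / b := by rw [le_div_iff₀ hb]; linarith
  have hla := Real.log_nonneg ha
  refine ⟨1 / Real.log 2 + D * (Real.log ((w + b) / b) / Real.log 2 + 1), by positivity,
    fun n k hn => ?_⟩
  have hn' : (2 : ℝ) ≤ n := by exact_mod_cast hn
  have hln : Real.log 2 ≤ Real.log n := Real.log_le_log two_pos hn'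
  have h1 : Real.log ((w + n * b) / (w + (k + 1 : ℕ) * b)) ≤ Real.log ((w + b) / b) + Real.log n := by
    rw [← Real.log_mul (by positivity) (by positivity)]
    refine Real.log_le_log (by positivity) ((ratio_le hw hb (by omega)).trans ?_)
    exact div_le_self (by positivity) (by linarith [Nat.cast_nonneg (α := ℝ) k])
  have h2 : 1 ≤ 1 / Real.log 2 * Real.log n := by
    rw [one_div_mul_eq_div, one_le_div hl2]; exact hln
  have h3 : Real.log ((w + b) / b) ≤ Real.log ((w + b) / b) / Real.log 2 * Real.log n := by
    rw [div_mul_eq_mul_div, le_div_iff₀ hl2]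
    gcongr
  calc 1 + D * Real.log ((w + n * b) / (w + (k + 1 : ℕ) * b))
      ≤ 1 / Real.log 2 * Real.log n +
        D * (Real.log ((w + b) / b) / Real.log 2 * Real.log n + Real.log n) := by
        gcongr
        linarith
    _ = _ := by ring

theorem exists_sum_growthFactor_sq_le_of_lt (hw : 0 < w) (hb : 0 < b) {rho D : ℝ} (hD : 0 < D)
    (hrho : rho < 1 / 2) (nu : ℕ) : ∃ K : ℝ, 0 < K ∧ ∀ n : ℕ, 2 ≤ n →
      ∑ k ∈ Finset.range n, growthFactor w b rho D nu n (k + 1) ^ 2 ≤ K * n := by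
  -- An exponent above `rho` absorbs the logarithms, positivity makes the power monotone in the
  -- ratio even if `rho` is negative, and `2 * sigma < 1` keeps the sum of order `n`.
  obtain ⟨sigma, h1, h2⟩ : ∃ sigma : ℝ, max rho 0 < sigma ∧ sigma < 1 / 2 :=
    exists_between (max_lt hrho (by norm_num))
  have hs0 : 0 < sigma := (le_max_right _ _).trans_lt h1
  have hs1 : 0 < 1 - 2 * sigma := by linarith
  obtain ⟨K, hK, hbound⟩ := exists_rpow_mul_log_pow_le ((le_max_left _ _).trans_lt h1) hD nu
  refine ⟨K ^ 2 * ((w + b) / b) ^ (2 * sigma) / (1 - 2 * sigma), by positivity, fun n hn => ?_⟩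
  have hn0 : (0 : ℝ) < n := by positivity
  calc ∑ k ∈ Finset.range n, growthFactor w b rho D nu n (k + 1) ^ 2
      ≤ ∑ k ∈ Finset.range n, K ^ 2 * (((w + b) / b) ^ (2 * sigma) * (n : ℝ) ^ (2 * sigma)) *
          (((k : ℝ) + 1) ^ (2 * sigma))⁻¹ := by
        refine Finset.sum_le_sum fun k hk => ?_
        have hkn : k + 1 ≤ n := Finset.mem_range.mp hk
        calc growthFactor w b rho D nu n (k + 1) ^ 2
            ≤ (K * ((w + b) / b * n / (k + 1)) ^ sigma) ^ 2 := by
              have := (growthFactor_pos hw hb (rho := rho) (nu := nu) hD hkn).le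
              have h4 := (hbound _ (one_le_ratio hw hb hkn))
              have h5 := ratio_le hw hb (n := n) (k := k) (by omega)
              have h6 := one_le_ratio hw hb hkn
              refine pow_le_pow_left₀ this (h4.trans ?_) 2
              gcongr
          _ = _ := by
              rw [mul_pow, ← Real.rpow_mul_natCast (by positivity),
                Real.div_rpow (by positivity) (by positivity),
                Real.mul_rpow (by positivity) hn0.le, mul_comm sigma]
              push_cast
              ring
    _ ≤ K ^ 2 * (((w + b) / b) ^ (2 * sigma) * (n : ℝ) ^ (2 * sigma)) *
          ((n : ℝ) ^ (1 - 2 * sigma) / (1 - 2 * sigma)) := by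
        rw [← Finset.mul_sum]
        gcongr
        exact sum_inv_rpow_le (by positivity) (by linarith) n
    _ = _ := by
        rw [Real.rpow_sub hn0, Real.rpow_one]
        field_simp

theorem exists_growthFactor_sq_le (hw : 0 < w) (hb : 0 < b) {rho D : ℝ} (hD : 0 < D)
    (hrho : 0 < rho) (nu : ℕ) : ∃ K : ℝ, 0 < K ∧ ∀ n k : ℕ, 2 ≤ n → k < n →
      growthFactor w b rho D nu n (k + 1) ^ 2 ≤
        K * (n : ℝ) ^ (2 * rho) * Real.log n ^ (2 * nu) * (((k : ℝ) + 1) ^ (2 * rho))⁻¹ := by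
  obtain ⟨K, hK, hbound⟩ := exists_one_add_log_ratio_le hw hb hD
  refine ⟨((w + b) / b) ^ (2 * rho) * K ^ (2 * nu), by positivity, fun n k hn hk => ?_⟩
  have hn0 : (0 : ℝ) < n := by positivity
  have hkn : k + 1 ≤ n := hk
  have h5 := ratio_le hw hb (n := n) (k := k) (by omega)
  have h6 := one_le_ratio hw hb hkn
  have h7 := Real.log_nonneg h6
  calc growthFactor w b rho D nu n (k + 1) ^ 2
      ≤ (((w + b) / b * n / (k + 1)) ^ rho * (K * Real.log n) ^ nu) ^ 2 := by
        have := (growthFactor_pos hw hb (rho := rho) (nu := nu) hD hkn).le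
        refine pow_le_pow_left₀ this ?_ 2
        unfold growthFactor
        gcongr
        exact hbound n k hn
    _ = _ := by
        rw [mul_pow, ← Real.rpow_mul_natCast (by positivity),
          Real.div_rpow (by positivity) (by positivity),
          Real.mul_rpow (by positivity) hn0.le, mul_comm rho]
        push_cast
        ring

theorem exists_sum_growthFactor_sq_le_of_eq (hw : 0 < w) (hb : 0 < b) {D : ℝ} (hD : 0 < D)
    (nu : ℕ) : ∃ K : ℝ, 0 < K ∧ ∀ n : ℕ, 2 ≤ n →
      ∑ k ∈ Finset.range n, growthFactor w b (1 / 2) D nu n (k + 1) ^ 2 ≤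
        K * (n * Real.log n ^ (2 * nu + 1)) := by
  obtain ⟨K, hK, hbound⟩ := exists_growthFactor_sq_le hw hb hD (one_half_pos (α := ℝ)) nu
  have hl2 : 0 < Real.log 2 := Real.log_pos one_lt_two
  refine ⟨K * (1 / Real.log 2 + 1), by positivity, fun n hn => ?_⟩
  have hn' : (2 : ℝ) ≤ n := by exact_mod_cast hn
  have hln : Real.log 2 ≤ Real.log n := Real.log_le_log two_pos hn'
  calc ∑ k ∈ Finset.range n, growthFactor w b (1 / 2) D nu n (k + 1) ^ 2
      ≤ ∑ k ∈ Finset.range n, K * n * Real.log n ^ (2 * nu) * ((k : ℝ) + 1)⁻¹ := by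
        refine Finset.sum_le_sum fun k hk => ?_
        have := hbound n k hn (Finset.mem_range.mp hk)
        simpa using this
    _ ≤ K * n * Real.log n ^ (2 * nu) * ((1 / Real.log 2 + 1) * Real.log n) := by
        rw [← Finset.mul_sum]
        gcongr
        have h2 : 1 ≤ 1 / Real.log 2 * Real.log n := by
          rw [one_div_mul_eq_div, one_le_div hl2]; exact hln
        linarith [sum_inv_le_one_add_log n]
    _ = _ := by ring

theorem exists_sum_growthFactor_sq_le_of_gt (hw : 0 < w) (hb : 0 < b) {rho D : ℝ} (hD : 0 < D)
    (hrho : 1 / 2 < rho) (nu : ℕ) : ∃ K : ℝ, 0 < K ∧ ∀ n : ℕ, 2 ≤ n →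
      ∑ k ∈ Finset.range n, growthFactor w b rho D nu n (k + 1) ^ 2 ≤
        K * ((n : ℝ) ^ (2 * rho) * Real.log n ^ (2 * nu)) := by
  obtain ⟨K, hK, hbound⟩ := exists_growthFactor_sq_le hw hb hD (by linarith : 0 < rho) nu
  obtain ⟨K', hK', hsum⟩ := exists_sum_inv_rpow_le (by linarith : 1 < 2 * rho)
  refine ⟨K * K', by positivity, fun n hn => ?_⟩
  calc ∑ k ∈ Finset.range n, growthFactor w b rho D nu n (k + 1) ^ 2
      ≤ ∑ k ∈ Finset.range n, K * (n : ℝ) ^ (2 * rho) * Real.log n ^ (2 * nu) *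
          (((k : ℝ) + 1) ^ (2 * rho))⁻¹ :=
        Finset.sum_le_sum fun k hk => hbound n k hn (Finset.mem_range.mp hk)
    _ ≤ K * (n : ℝ) ^ (2 * rho) * Real.log n ^ (2 * nu) * K' := by
        rw [← Finset.mul_sum]
        gcongr
        exact hsum n
    _ = _ := by ring

theorem half_le_log {n : ℕ} (hn : 2 ≤ n) : 1 / 2 ≤ Real.log n := by
  have hn' : (2 : ℝ) ≤ n := by exact_mod_cast hn
  linarith [Real.log_two_gt_d9, Real.log_le_log two_pos hn']

/-- Absorbing an additive constant under a square root. -/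
theorem sqrt_one_add_mul_le {K K' t S T : ℝ} (hK : 0 ≤ K) (ht : 0 < t) (hS : S ≤ K' * T)
    (hT : t ≤ T) : √(1 + K * S) ≤ √(1 / t + K * K') * √T := by
  have hT0 : 0 < T := ht.trans_le hT
  rw [← Real.sqrt_mul' _ hT0.le]
  refine Real.sqrt_le_sqrt ?_
  have h1 : 1 ≤ 1 / t * T := by rw [one_div_mul_eq_div, one_le_div ht]; exact hT
  calc 1 + K * S ≤ 1 / t * T + K * (K' * T) := by gcongr
    _ = _ := by ring

end Sums

/-! ### Variation of constants -/

section Propagator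

variable {V : Type*} [AddCommGroup V] [Module ℂ V]

/-- The product `(1 + c_{j-1}⁻¹ T) ⋯ (1 + c_i⁻¹ T)`. -/
def propagator (T : Module.End ℂ V) (c : ℕ → ℝ) (i : ℕ) : ℕ → Module.End ℂ V
  | 0 => 1
  -- The value is the identity whenever the final time does not exceed `i`.
  | j + 1 => if i ≤ j then (1 + ((c j : ℂ)⁻¹) • T) * propagator T c i j else 1

theorem propagator_self (T : Module.End ℂ V) (c : ℕ → ℝ) (i : ℕ) : propagator T c i i = 1 := by
  cases i <;> simp [propagator]

theorem propagator_succ_apply (T : Module.End ℂ V) (c : ℕ → ℝ) {i j : ℕ} (hij : i ≤ j) (x : V) :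
    propagator T c i (j + 1) x =
      propagator T c i j x + ((c j : ℂ)⁻¹) • T (propagator T c i j x) := by
  simp [propagator, hij]

theorem commute_propagator {T S : Module.End ℂ V} (h : Commute S T) (c : ℕ → ℝ) (i j : ℕ) :
    Commute S (propagator T c i j) := by
  induction j with
  | zero => exact Commute.one_right S
  | succ j ih =>
    rw [propagator]
    split_ifs
    · exact ((Commute.one_right S).add_right (h.smul_right _)).mul_right ih
    · exact Commute.one_right S

/-- Variation of constants for `z_{n+1} = (1 + c_n⁻¹ T) z_n + e_n`. -/
theorem eq_sum_propagator {T : Module.End ℂ V} {c : ℕ → ℝ} {z e : ℕ → V} (h0 : z 0 = 0)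
    (h : ∀ n, z (n + 1) = z n + ((c n : ℂ)⁻¹) • T (z n) + e n) (n : ℕ) :
    z n = ∑ k ∈ Finset.range n, propagator T c (k + 1) n (e k) := by
  induction n with
  | zero => simpa using h0
  | succ n ih =>
    -- The disturbance `e k` enters at time `k + 1`, so the newest one is not yet propagated.
    rw [Finset.sum_range_succ, propagator_self, Module.End.one_apply, h n]
    congr 1
    rw [ih, map_sum, Finset.smul_sum, ← Finset.sum_add_distrib]
    exact Finset.sum_congr rfl fun k hk =>
      (propagator_succ_apply T c (Finset.mem_range.mp hk) _).symm

end Propagator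

/-- The projection commutes with the propagator, so the projected orbit stays in the range of `P`,
where `f` is `λ + N`, and `exists_norm_recursion_le` applies. Its initial data `N ^ m (P x)` are
controlled by finitely many operator norms. -/
theorem exists_norm_spectralProj_propagator_le {V : Type*} [NormedAddCommGroup V]
    [NormedSpace ℂ V] [FiniteDimensional ℂ V] (f : Module.End ℂ V) (lam : ℂ) {w b : ℝ}
    (hw : 0 < w) (hb : 0 < b) :
    ∃ C D : ℝ, 0 < C ∧ 0 < D ∧ ∀ (i j : ℕ) (x : V), i ≤ j →
      ‖spectralProj f lam (propagator f (fun k => w + k * b) i j x)‖ ≤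
        C * growthFactor w b (lam.re / b) D (spectralIndex f lam) j i * ‖x‖ := by
  set N := spectralNilpotent f lam
  set P := spectralProj f lam
  set nu := spectralIndex f lam
  obtain ⟨C, D, hC, hD, hbound⟩ := exists_norm_recursion_le
    (spectralNilpotent_pow_eq_zero f lam) lam hw hb
  set B : ℝ := ∑ m ∈ Finset.range (nu + 1), ‖LinearMap.toContinuousLinearMap (N ^ m * P)‖ + 1
  have hB0 : 0 < B := by positivity
  refine ⟨C * B, D, by positivity, hD, fun i j x hij => ?_⟩
  have hcomm : ∀ k, P (propagator f (fun k => w + k * b) i k x) =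
      propagator f (fun k => w + k * b) i k (P x) := fun k =>
    LinearMap.congr_fun (commute_propagator (commute_spectralProj f lam) _ i k).eq x
  have key := hbound (fun k => P (propagator f (fun k => w + k * b) i k x)) (B * ‖x‖) i j hij
    (fun k hk => ?_) (fun m hm => ?_)
  · refine key.trans_eq ?_
    unfold growthFactor
    ring
  · rw [hcomm, propagator_succ_apply _ _ hk,
      ← apply_eq_of_spectralProj_eq (f := f) (lam := lam), ← hcomm]
    exact spectralProj_idem f lam _
  · rw [propagator_self, Module.End.one_apply, ← Module.End.mul_apply]
    refine ((LinearMap.toContinuousLinearMap (N ^ m * P)).le_opNorm x).trans ?_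
    gcongr
    refine (Finset.single_le_sum (f := fun m => ‖LinearMap.toContinuousLinearMap (N ^ m * P)‖)
      (fun _ _ => norm_nonneg _) (Finset.mem_range.mpr (Nat.lt_succ_of_le hm))).trans ?_
    exact le_add_of_nonneg_right zero_le_one

/-! ### Passage between complex vectors and real scalar coordinates -/

theorem norm_toComplexVec {q : ℕ} (x : EuclideanSpace ℝ (Fin q)) : ‖toComplexVec x‖ = ‖x‖ := by
  simp [EuclideanSpace.norm_eq, toComplexVec]

theorem toComplexVec_add {q : ℕ} (x y : EuclideanSpace ℝ (Fin q)) :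
    toComplexVec (x + y) = toComplexVec x + toComplexVec y := by
  ext i
  simp [toComplexVec]

theorem toComplexVec_smul {q : ℕ} (c : ℝ) (x : EuclideanSpace ℝ (Fin q)) :
    toComplexVec (c • x) = (c : ℂ) • toComplexVec x := by
  ext i
  simp [toComplexVec]

/-- The real linear functional `x ↦ φ ((S x)_i)` on real vectors. -/
def coordFunctional {q : ℕ} (φ : ℂ →ₗ[ℝ] ℝ) (S : Module.End ℂ (EuclideanSpace ℂ (Fin q)))
    (i : Fin q) : EuclideanSpace ℝ (Fin q) →L[ℝ] ℝ :=
  LinearMap.toContinuousLinearMap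
    { toFun := fun x => φ (S (toComplexVec x) i)
      map_add' := fun x y => by simp [toComplexVec_add]
      map_smul' := fun c x => by
        rw [toComplexVec_smul, map_smul, PiLp.smul_apply, smul_eq_mul, ← Complex.real_smul,
          map_smul]
        rfl }

theorem coordFunctional_apply {q : ℕ} (φ : ℂ →ₗ[ℝ] ℝ)
    (S : Module.End ℂ (EuclideanSpace ℂ (Fin q))) (i : Fin q) (x : EuclideanSpace ℝ (Fin q)) :
    coordFunctional φ S i x = φ (S (toComplexVec x) i) := rfl

theorem norm_le_sum_abs_re_add_abs_im {q : ℕ} (v : EuclideanSpace ℂ (Fin q)) :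
    ‖v‖ ≤ ∑ i, (|(v i).re| + |(v i).im|) := by
  have h : ‖v‖ ≤ ∑ i, ‖v i‖ := by
    rw [EuclideanSpace.norm_eq]
    refine (Real.sqrt_le_left (Finset.sum_nonneg fun i _ => norm_nonneg _)).mpr ?_
    exact Finset.sum_sq_le_sq_sum_of_nonneg fun i _ => norm_nonneg _
  exact h.trans (Finset.sum_le_sum fun i _ => Complex.norm_le_abs_re_add_abs_im _)

theorem eLpNorm_le_of_re_im {q : ℕ} {Ω : Type*} {m : MeasurableSpace Ω} {μ : Measure Ω} {r : ℝ≥0∞}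
    (hr : 1 ≤ r) {v : Ω → EuclideanSpace ℂ (Fin q)} {S : ℝ} (hS : 0 ≤ S)
    (hre : ∀ i, AEStronglyMeasurable (fun ω => (v ω i).re) μ)
    (him : ∀ i, AEStronglyMeasurable (fun ω => (v ω i).im) μ)
    (hreS : ∀ i, eLpNorm (fun ω => (v ω i).re) r μ ≤ ENNReal.ofReal S)
    (himS : ∀ i, eLpNorm (fun ω => (v ω i).im) r μ ≤ ENNReal.ofReal S) :
    eLpNorm v r μ ≤ ENNReal.ofReal (2 * q * S) := by
  calc eLpNorm v r μ
      ≤ eLpNorm (∑ i, ((fun ω => ‖(v ω i).re‖) + fun ω => ‖(v ω i).im‖)) r μ := by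
        refine eLpNorm_mono_real fun ω => ?_
        simpa using norm_le_sum_abs_re_add_abs_im (v ω)
    _ ≤ ∑ i : Fin q, (ENNReal.ofReal S + ENNReal.ofReal S) := by
        refine (eLpNorm_sum_le (fun i _ => (hre i).norm.add (him i).norm) hr).trans ?_
        refine Finset.sum_le_sum fun i _ =>
          (eLpNorm_add_le (hre i).norm (him i).norm hr).trans (add_le_add ?_ ?_)
        · exact (eLpNorm_norm _).trans_le (hreS i)
        · exact (eLpNorm_norm _).trans_le (himS i)
    _ = ENNReal.ofReal (2 * q * S) := by
        rw [Finset.sum_const, Finset.card_univ, Fintype.card_fin, nsmul_eq_mul,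
          ← ENNReal.ofReal_add hS hS, ← ENNReal.ofReal_natCast q,
          ← ENNReal.ofReal_mul (Nat.cast_nonneg q)]
        congr 1
        ring

/-! ### Moment bounds for the spectral components -/

namespace PolyaUrn

variable {q : ℕ} {U : PolyaUrn q}

/-- `meanDrift` as a continuous linear map. -/
def meanDriftCLM (U : PolyaUrn q) : EuclideanSpace ℝ (Fin q) →L[ℝ] EuclideanSpace ℝ (Fin q) where
  toFun := U.meanDrift
  map_add' x y := by simp [meanDrift, mul_add, add_smul, Finset.sum_add_distrib]
  map_smul' c x := by
    simp only [meanDrift, PiLp.smul_apply, smul_eq_mul, RingHom.id_apply, Finset.smul_sum,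
      smul_smul]
    exact Finset.sum_congr rfl fun i _ => by ring_nf
  cont := continuous_meanDrift

theorem intensityMap_toComplexVec {p : ℝ} (hp : 1 ≤ p) (hmom : U.HasFiniteMoments p)
    (x : EuclideanSpace ℝ (Fin q)) :
    U.intensityMap (toComplexVec x) = toComplexVec (U.meanDrift x) := by
  ext i
  have hm : ∀ j, U.meanReplacement j i = ∫ x, x i ∂U.replacement j := fun j =>
    eval_integral_piLp (f := fun x : EuclideanSpace ℝ (Fin q) => x)
      (fun k => (EuclideanSpace.proj (𝕜 := ℝ) k).integrable_comp (hmom.integrable hp j)) i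
  simp only [intensityMap, Matrix.toLpLin_apply, toComplexVec, Matrix.mulVec, dotProduct,
    intensityMatrix, Matrix.of_apply, meanDrift, WithLp.ofLp_sum, Finset.sum_apply,
    WithLp.ofLp_smul, Pi.smul_apply, smul_eq_mul, hm]
  push_cast
  exact Finset.sum_congr rfl fun j _ => by ring

namespace IsRealization

variable {Ω : Type*} {m : MeasurableSpace Ω} {μ : Measure Ω} [IsProbabilityMeasure μ]
  {ℱ : Filtration ℕ m} {X : ℕ → Ω → EuclideanSpace ℝ (Fin q)} {draw : ℕ → Ω → Fin q}

theorem integral_succ (hR : U.IsRealization μ ℱ X draw) {b p : ℝ} (hb : U.IsBalanced b)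
    (hp : 1 ≤ p) (hmom : U.HasFiniteMoments p) (hT : U.IsTenable μ X) (n : ℕ) :
    ∫ ω, X (n + 1) ω ∂μ = ∫ ω, X n ω ∂μ +
      (U.totalActivity U.init + n * b)⁻¹ • U.meanDrift (∫ ω, X n ω ∂μ) := by
  have hp0 : 0 < p := by linarith
  have hX : Integrable (X n) μ := (hR.memLp hp0 hmom n).integrable (by simpa using hp)
  have hD := (hR.memLp_centredIncrement hb hp0 hmom hT n).integrable (by simpa using hp)
  have hA : Integrable (fun ω => U.meanDrift (X n ω)) μ := U.meanDriftCLM.integrable_comp hX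
  have hAint : ∫ ω, U.meanDrift (X n ω) ∂μ = U.meanDrift (∫ ω, X n ω ∂μ) :=
    U.meanDriftCLM.integral_comp_comm hX
  have hzero : ∫ ω, U.centredIncrement b X n ω ∂μ = 0 := by
    rw [← integral_condExp (ℱ.le n),
      integral_congr_ae (hR.condExp_centredIncrement hb hp hmom hT n)]
    simp
  calc ∫ ω, X (n + 1) ω ∂μ = ∫ ω, (X n ω + (U.totalActivity U.init + n * b)⁻¹ •
        U.meanDrift (X n ω)) + U.centredIncrement b X n ω ∂μ := by
        refine integral_congr_ae (ae_of_all _ fun ω => ?_)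
        simp only [centredIncrement]
        abel
    _ = _ := by
        have hA' : Integrable (fun ω => (U.totalActivity U.init + n * b)⁻¹ •
          U.meanDrift (X n ω)) μ := hA.fun_smul _
        have hXA : Integrable (fun ω => X n ω + (U.totalActivity U.init + n * b)⁻¹ •
          U.meanDrift (X n ω)) μ := hX.add hA'
        rw [integral_add hXA hD, integral_add hX hA', integral_smul, hAint, hzero, add_zero]

/-- The centred composition as a sum of propagated martingale differences. -/
theorem ae_toComplexVec_sub_integral_eq (hR : U.IsRealization μ ℱ X draw) {b p : ℝ}
    (hb : U.IsBalanced b) (hp : 1 ≤ p) (hmom : U.HasFiniteMoments p) (hT : U.IsTenable μ X)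
    (n : ℕ) : ∀ᵐ ω ∂μ, toComplexVec (X n ω - ∫ ω', X n ω' ∂μ) =
      ∑ k ∈ Finset.range n, propagator U.intensityMap
        (fun k => U.totalActivity U.init + k * b) (k + 1) n
        (toComplexVec (U.centredIncrement b X k ω)) := by
  filter_upwards [hR.init_eq] with ω hω
  -- Since `X 0` is almost surely constant, the centred process starts at zero and only the noise
  -- contributes.
  refine eq_sum_propagator (z := fun n => toComplexVec (X n ω - ∫ ω', X n ω' ∂μ))
    (c := fun k => U.totalActivity U.init + k * b) ?_ (fun n => ?_) n
  · have h0 : ∫ ω', X 0 ω' ∂μ = U.init := by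
      rw [integral_congr_ae hR.init_eq]
      simp
    rw [h0, hω, sub_self]
    ext i
    simp [toComplexVec]
  · rw [intensityMap_toComplexVec hp hmom, ← Complex.ofReal_inv, ← toComplexVec_smul,
      ← toComplexVec_add, ← toComplexVec_add, hR.integral_succ hb hp hmom hT n]
    congr 1
    have hsub : U.meanDrift (X n ω - ∫ ω', X n ω' ∂μ) =
        U.meanDrift (X n ω) - U.meanDrift (∫ ω', X n ω' ∂μ) := U.meanDriftCLM.map_sub _ _
    rw [hsub, smul_sub, centredIncrement]
    abel

end IsRealization

/-- The martingale bound for the spectral components, before summing the growth factors. -/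
theorem exists_eLpNorm_spectralProj_le {b p : ℝ} (hb : U.IsBalanced b) (hp : 2 ≤ p)
    (hmom : U.HasFiniteMoments p) (hw : 0 < U.totalActivity U.init) (lam : ℂ) :
    ∃ K D : ℝ, 0 < K ∧ 0 < D ∧ ∀ (Ω : Type*) (m : MeasurableSpace Ω) (μ : Measure Ω)
      (ℱ : Filtration ℕ m) (X : ℕ → Ω → EuclideanSpace ℝ (Fin q)) (draw : ℕ → Ω → Fin q),
      IsProbabilityMeasure μ → U.IsRealization μ ℱ X draw → U.IsTenable μ X → ∀ n : ℕ,
      eLpNorm (fun ω => spectralProj U.intensityMap lam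
          (toComplexVec (X n ω - ∫ ω', X n ω' ∂μ))) (ENNReal.ofReal p) μ ≤
        ENNReal.ofReal (2 * q * √(1 + K * ∑ k ∈ Finset.range n,
          growthFactor (U.totalActivity U.init) b (lam.re / b) D
            (spectralIndex U.intensityMap lam) n (k + 1) ^ 2)) := by
  obtain ⟨C, D, hC, hD, hbound⟩ :=
    exists_norm_spectralProj_propagator_le U.intensityMap lam hw hb.1
  set w := U.totalActivity U.init
  -- The added `1` makes the bounds on the martingale differences strictly positive, as the moment
  -- inequality requires.
  set R := U.centredIncrementBound p + 1
  have hR0 : 0 < R := by linarith [U.centredIncrementBound_nonneg p]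
  have hc := one_le_expansionConst hp
  refine ⟨2 * expansionConst p * (C * R) ^ 2, D, by positivity, hD,
    fun Ω m μ ℱ X draw _ hR hT n => ?_⟩
  have hp0 : 0 < p := by linarith
  have hp1 : 1 ≤ p := by linarith
  set P := spectralProj U.intensityMap lam
  set Φ := propagator U.intensityMap (fun k => w + k * b)
  set g := fun k => growthFactor w b (lam.re / b) D (spectralIndex U.intensityMap lam) n (k + 1)
  set Y := U.centredIncrement b X
  have hgpos : ∀ k < n, 0 < g k := fun k hk => growthFactor_pos hw hb.1 hD hk
  -- For fixed `n`, a deterministic linear functional of `Y k` is still a martingale difference, so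
  -- the real inequality applies to the real and imaginary part of each coordinate.
  have hscalar : ∀ φ : ℂ →ₗ[ℝ] ℝ, (∀ z, |φ z| ≤ ‖z‖) → ∀ i : Fin q,
      eLpNorm (fun ω => ∑ k ∈ Finset.range n, coordFunctional φ (P * Φ (k + 1) n) i (Y k ω))
        (ENNReal.ofReal p) μ ≤
      ENNReal.ofReal √(1 + 2 * expansionConst p * (C * R) ^ 2 *
        ∑ k ∈ Finset.range n, g k ^ 2) := by
    intro φ hφ i
    have hYp := hR.memLp_centredIncrement hb hp0 hmom hT
    refine (eLpNorm_sum_martingaleDifference_le hp (ℱ := ℱ)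
      (d := fun k ω => coordFunctional φ (P * Φ (k + 1) n) i (Y k ω))
      (fun k => (coordFunctional φ (P * Φ (k + 1) n) i).continuous.comp_stronglyMeasurable
        (hR.stronglyMeasurable_centredIncrement b k))
      (fun k => (coordFunctional φ (P * Φ (k + 1) n) i).comp_memLp' (hYp k))
      (fun k => ?_) (t := fun k => C * R * g k)
      (fun k hk => by have := hgpos k hk; positivity) (fun k hk => ?_) one_pos).trans_eq ?_
    · have h1 := (coordFunctional φ (P * Φ (k + 1) n) i).comp_condExp_comm (m := ℱ k)
        ((hYp k).integrable (by simpa using hp1))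
      filter_upwards [h1, hR.condExp_centredIncrement hb hp1 hmom hT k] with ω h2 h3
      refine h2.symm.trans ?_
      rw [Function.comp_apply, h3]
      simp
    · have hle : ∀ ω, ‖coordFunctional φ (P * Φ (k + 1) n) i (Y k ω)‖ ≤
          (C * g k) * ‖Y k ω‖ := fun ω => by
        rw [coordFunctional_apply]
        refine (hφ _).trans ((PiLp.norm_apply_le _ i).trans ?_)
        rw [Module.End.mul_apply]
        refine (hbound (k + 1) n _ hk).trans_eq ?_
        rw [norm_toComplexVec]
      refine (eLpNorm_le_mul_eLpNorm_of_ae_le_mul (ae_of_all _ hle) _).trans ?_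
      rw [show C * R * g k = (C * g k) * R by ring,
        ENNReal.ofReal_mul (mul_nonneg hC.le (hgpos k hk).le)]
      gcongr
      exact (hR.eLpNorm_centredIncrement_le hb hp1 hmom hT k).trans
        (ENNReal.ofReal_le_ofReal (by linarith))
    · congr 3
      rw [mul_assoc (2 * expansionConst p), Finset.mul_sum _ _ ((C * R) ^ 2)]
      simp only [mul_pow]
  set S := √(1 + 2 * expansionConst p * (C * R) ^ 2 * ∑ k ∈ Finset.range n, g k ^ 2)
  have hmeas : ∀ (φ : ℂ →ₗ[ℝ] ℝ) (i : Fin q), AEStronglyMeasurable (fun ω =>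
      ∑ k ∈ Finset.range n, coordFunctional φ (P * Φ (k + 1) n) i (Y k ω)) μ := fun φ i =>
    Finset.aestronglyMeasurable_fun_sum _ fun k _ =>
      (coordFunctional φ (P * Φ (k + 1) n) i).continuous.comp_aestronglyMeasurable
        (hR.memLp_centredIncrement hb hp0 hmom hT k).1
  have hcoord : ∀ (φ : ℂ →ₗ[ℝ] ℝ) (i : Fin q) (ω : Ω),
      φ ((P (∑ k ∈ Finset.range n, Φ (k + 1) n (toComplexVec (Y k ω)))) i) =
      ∑ k ∈ Finset.range n, coordFunctional φ (P * Φ (k + 1) n) i (Y k ω) := fun φ i ω => by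
    rw [map_sum, WithLp.ofLp_sum, Finset.sum_apply, map_sum]
    rfl
  rw [eLpNorm_congr_ae (g := fun ω => P (∑ k ∈ Finset.range n, Φ (k + 1) n
    (toComplexVec (Y k ω)))) ((hR.ae_toComplexVec_sub_integral_eq hb hp1 hmom hT n).mono
      fun ω hω => congrArg P hω)]
  have hre : ∀ i, (fun ω => ((P (∑ k ∈ Finset.range n, Φ (k + 1) n
      (toComplexVec (Y k ω)))) i).re) = fun ω => ∑ k ∈ Finset.range n,
        coordFunctional Complex.reLm (P * Φ (k + 1) n) i (Y k ω) :=
    fun i => funext fun ω => hcoord Complex.reLm i ω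
  have him : ∀ i, (fun ω => ((P (∑ k ∈ Finset.range n, Φ (k + 1) n
      (toComplexVec (Y k ω)))) i).im) = fun ω => ∑ k ∈ Finset.range n,
        coordFunctional Complex.imLm (P * Φ (k + 1) n) i (Y k ω) :=
    fun i => funext fun ω => hcoord Complex.imLm i ω
  refine eLpNorm_le_of_re_im (by simpa using hp1) (Real.sqrt_nonneg _) (fun i => ?_)
    (fun i => ?_) (fun i => ?_) (fun i => ?_)
  · rw [hre]
    exact hmeas _ i
  · rw [him]
    exact hmeas _ i
  · rw [hre]
    exact hscalar _ Complex.abs_re_le_norm i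
  · rw [him]
    exact hscalar _ Complex.abs_im_le_norm i

/-- The moment bound for a single eigenvalue, with a constant that may depend on it. -/
theorem exists_eLpNorm_spectralProj_le_rate {b p : ℝ} (hb : U.IsBalanced b) (hp : 2 ≤ p)
    (hmom : U.HasFiniteMoments p) (hw : 0 < U.totalActivity U.init) (lam : ℂ) :
    ∃ C : ℝ, 0 ≤ C ∧ ∀ (Ω : Type*) (m : MeasurableSpace Ω) (μ : Measure Ω)
      (ℱ : Filtration ℕ m) (X : ℕ → Ω → EuclideanSpace ℝ (Fin q)) (draw : ℕ → Ω → Fin q),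
      IsProbabilityMeasure μ → U.IsRealization μ ℱ X draw → U.IsTenable μ X →
      ∀ n : ℕ, 2 ≤ n →
        (lam.re < b / 2 →
          eLpNorm (fun ω => spectralProj U.intensityMap lam
              (toComplexVec (X n ω - ∫ ω', X n ω' ∂μ))) (ENNReal.ofReal p) μ
            ≤ ENNReal.ofReal (C * (n : ℝ) ^ (1 / 2 : ℝ))) ∧
        (lam.re = b / 2 →
          eLpNorm (fun ω => spectralProj U.intensityMap lam
              (toComplexVec (X n ω - ∫ ω', X n ω' ∂μ))) (ENNReal.ofReal p) μ
            ≤ ENNReal.ofReal (C * (n : ℝ) ^ (1 / 2 : ℝ) *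
                Real.log n ^ ((spectralIndex U.intensityMap lam : ℝ) + 1 / 2))) ∧
        (b / 2 < lam.re →
          eLpNorm (fun ω => spectralProj U.intensityMap lam
              (toComplexVec (X n ω - ∫ ω', X n ω' ∂μ))) (ENNReal.ofReal p) μ
            ≤ ENNReal.ofReal (C * (n : ℝ) ^ (lam.re / b) *
                Real.log n ^ spectralIndex U.intensityMap lam)) := by
  obtain ⟨K, D, hK, hD, hmain⟩ := exists_eLpNorm_spectralProj_le hb hp hmom hw lam
  have hb0 := hb.1
  set nu := spectralIndex U.intensityMap lam
  rcases lt_trichotomy lam.re (b / 2) with h | h | h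
  · have hrho : lam.re / b < 1 / 2 := by rw [div_lt_iff₀ hb0]; linarith
    obtain ⟨K', hK', hsum⟩ := exists_sum_growthFactor_sq_le_of_lt hw hb0 hD hrho nu
    refine ⟨2 * q * √(1 / 2 + K * K'), by positivity, fun Ω m μ ℱ X draw hμ hR hT n hn =>
      ⟨fun _ => ?_, fun h' => absurd h' h.ne, fun h' => absurd h' h.not_gt⟩⟩
    refine (hmain Ω m μ ℱ X draw hμ hR hT n).trans (ENNReal.ofReal_le_ofReal ?_)
    rw [mul_assoc (2 * (q : ℝ)), ← Real.sqrt_eq_rpow]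
    gcongr
    exact sqrt_one_add_mul_le hK.le two_pos (hsum n hn) (by exact_mod_cast hn)
  · have hrho : lam.re / b = 1 / 2 := by rw [h]; field_simp
    obtain ⟨K', hK', hsum⟩ := exists_sum_growthFactor_sq_le_of_eq hw hb0 hD nu
    -- The denominator is a lower bound for `n * log n ^ (2 * nu + 1)` over `n ≥ 2`, used to absorb
    -- the additive `1` under the square root; the other two cases treat their rates in the same
    -- way.
    refine ⟨2 * q * √(1 / (2 * (1 / 2) ^ (2 * nu + 1)) + K * K'), by positivity,
      fun Ω m μ ℱ X draw hμ hR hT n hn =>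
      ⟨fun h' => absurd h h'.ne, fun _ => ?_, fun h' => absurd h h'.ne'⟩⟩
    have hlog := half_le_log hn
    have hn' : (2 : ℝ) ≤ n := by exact_mod_cast hn
    refine (hmain Ω m μ ℱ X draw hμ hR hT n).trans (ENNReal.ofReal_le_ofReal ?_)
    have hsqrt : √(n * Real.log n ^ (2 * nu + 1)) =
        (n : ℝ) ^ (1 / 2 : ℝ) * Real.log n ^ ((nu : ℝ) + 1 / 2) := by
      rw [Real.sqrt_eq_rpow, Real.mul_rpow (by positivity) (by positivity), ← Real.rpow_natCast,
        ← Real.rpow_mul (by linarith)]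
      congr 2
      push_cast
      ring
    rw [mul_assoc _ ((n : ℝ) ^ (1 / 2 : ℝ)), mul_assoc (2 * (q : ℝ)), ← hsqrt, hrho]
    gcongr
    exact sqrt_one_add_mul_le hK.le (by positivity) (hsum n hn) (by gcongr)
  · have hrho : 1 / 2 < lam.re / b := by rw [lt_div_iff₀ hb0]; linarith
    obtain ⟨K', hK', hsum⟩ := exists_sum_growthFactor_sq_le_of_gt hw hb0 hD hrho nu
    refine ⟨2 * q * √(1 / (1 * (1 / 2) ^ (2 * nu)) + K * K'), by positivity,
      fun Ω m μ ℱ X draw hμ hR hT n hn =>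
      ⟨fun h' => absurd h h'.not_gt, fun h' => absurd h' h.ne', fun _ => ?_⟩⟩
    have hlog := half_le_log hn
    have hn' : (2 : ℝ) ≤ n := by exact_mod_cast hn
    refine (hmain Ω m μ ℱ X draw hμ hR hT n).trans (ENNReal.ofReal_le_ofReal ?_)
    have hsqrt : √((n : ℝ) ^ (2 * (lam.re / b)) * Real.log n ^ (2 * nu)) =
        (n : ℝ) ^ (lam.re / b) * Real.log n ^ nu := by
      rw [Real.sqrt_eq_iff_mul_self_eq (by positivity) (by positivity), two_mul (lam.re / b),
        Real.rpow_add (by linarith)]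
      ring
    rw [mul_assoc _ ((n : ℝ) ^ (lam.re / b)), mul_assoc (2 * (q : ℝ)), ← hsqrt]
    gcongr
    refine sqrt_one_add_mul_le hK.le (by positivity) (hsum n hn) ?_
    gcongr
    exact Real.one_le_rpow (by linarith) (by linarith)

end PolyaUrn

end

theorem theorem3p3 {q : ℕ} (U : PolyaUrn q) (b : ℝ) (hb : U.IsBalanced b)
    (p : ℝ) (hp : 2 ≤ p) (hmom : U.HasFiniteMoments p) :
    ∃ C : ℝ, ∀ (Ω : Type*) (m : MeasurableSpace Ω) (μ : Measure Ω) (ℱ : Filtration ℕ m)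
      (X : ℕ → Ω → EuclideanSpace ℝ (Fin q)) (draw : ℕ → Ω → Fin q),
      IsProbabilityMeasure μ → U.IsRealization μ ℱ X draw → U.IsTenable μ X →
      (∀ n, MemLp (X n) (ENNReal.ofReal p) μ) ∧
      ∀ lam : ℂ, U.intensityMap.HasEigenvalue lam → ∀ n : ℕ, 2 ≤ n →
        (lam.re < b / 2 →
          eLpNorm (fun ω => spectralProj U.intensityMap lam
              (toComplexVec (X n ω - ∫ ω', X n ω' ∂μ))) (ENNReal.ofReal p) μ
            ≤ ENNReal.ofReal (C * (n : ℝ) ^ (1 / 2 : ℝ))) ∧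
        (lam.re = b / 2 →
          eLpNorm (fun ω => spectralProj U.intensityMap lam
              (toComplexVec (X n ω - ∫ ω', X n ω' ∂μ))) (ENNReal.ofReal p) μ
            ≤ ENNReal.ofReal (C * (n : ℝ) ^ (1 / 2 : ℝ) *
                Real.log n ^ ((spectralIndex U.intensityMap lam : ℝ) + 1 / 2))) ∧
        (b / 2 < lam.re →
          eLpNorm (fun ω => spectralProj U.intensityMap lam
              (toComplexVec (X n ω - ∫ ω', X n ω' ∂μ))) (ENNReal.ofReal p) μ
            ≤ ENNReal.ofReal (C * (n : ℝ) ^ (lam.re / b) *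
                Real.log n ^ spectralIndex U.intensityMap lam)) := by
  have hmemLp : ∀ {Ω : Type _} {m : MeasurableSpace Ω} {μ : Measure Ω} {ℱ : Filtration ℕ m}
      {X : ℕ → Ω → EuclideanSpace ℝ (Fin q)} {draw : ℕ → Ω → Fin q} [IsProbabilityMeasure μ],
      U.IsRealization μ ℱ X draw → ∀ n, MemLp (X n) (ENNReal.ofReal p) μ :=
    fun hR n => hR.memLp (by linarith) hmom n
  by_cases hw : 0 < U.totalActivity U.init
  · choose C hC0 hC using
      PolyaUrn.exists_eLpNorm_spectralProj_le_rate hb hp hmom hw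
    have hfin := U.intensityMap.finite_hasEigenvalue
    -- There are finitely many eigenvalues, so the sum of their nonnegative constants serves all of
    -- them.
    refine ⟨∑ lam ∈ hfin.toFinset, C lam, fun Ω m μ ℱ X draw hμ hR hT =>
      ⟨hmemLp hR, fun lam hlam n hn => ?_⟩⟩
    have hle : C lam ≤ ∑ lam ∈ hfin.toFinset, C lam :=
      Finset.single_le_sum (fun l _ => hC0 l) (hfin.mem_toFinset.mpr hlam)
    have hlog : 0 ≤ Real.log n := Real.log_natCast_nonneg n
    obtain ⟨h1, h2, h3⟩ := hC lam Ω m μ ℱ X draw hμ hR hT n hn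
    refine ⟨fun h => (h1 h).trans ?_, fun h => (h2 h).trans ?_, fun h => (h3 h).trans ?_⟩ <;>
    gcongr
  -- Tenability at time `0` forces positive initial activity, so in this case there is no tenable
  -- realization and any constant will do.
  · refine ⟨0, fun Ω m μ ℱ X draw hμ hR hT => absurd ?_ hw⟩
    obtain ⟨ω, h0, h1⟩ := (hR.init_eq.and (hT 0)).exists
    rw [← h0]
    exact h1.2
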